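/- Let $d\ge 1$ and $p\ge 2$ be integers and let $\Omega\subset\mathbb R^d$ be a bounded open set with Lipschitz boundary (locally, in suitable Cartesian coordinates, $\Omega$ is the part of a cylinder lying above the graph of a Lipschitz function). Let $(\Omega_{n,k})$, $n\in\mathbb N_0$, $0\le k<p^n$, be a regular weakly balanced $p$-multiscale decomposition of $\Omega$, i.e. a family of non-empty measurable subsets of $\Omega$ such that - $\Omega_{0,0}=\Omega$; for each $n$ the sets $\Omega_{n,k}$ are pairwise disjoint; $\Omega_{n+1,pk+j}\subset\Omega_{n,k}$ for $0\le j<p$, and $\big|\Omega_{n,k}\setminus\bigcup_{j=0}^{p-1}\Omega_{n+1,pk+j}\big|=0$; - there is $C_0\ge 1$ with $C_0^{-1}|\Omega|p^{-n}\le|\Omega_{n,k}|\le C_0|\Omega|p^{-n}$ for all $n,k$; - there are $c_1,c_2>0$ with $\operatorname{diam}\Omega_{n,k}\le c_1p^{-n/d}$ and $|\Omega_{n,k}\setminus(\Omega_{n,k}+h)|\le c_2|h|\,p^{-n(d-1)/d}$ for all $n,k$ and all $h\in\mathbb R^d$. Let $P_n$ be the orthogonal projector of $L^2(\Omega)$ (complex-valued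 functions) onto $V_n=\operatorname{span}\{\mathbf 1_{\Omega_{n,k}}:0\le k<p^n\}$. For $r>0$ let $$\|f\|_{A^r(\Omega)}^2=\|P_0f\|_{L^2(\Omega)}^2+\sum_{n=0}^\infty p^{2nr/d}\|f-P_nf\|_{L^2(\Omega)}^2,\qquad A^r(\Omega)=\{f\in L^2(\Omega):\|f\|_{A^r(\Omega)}<\infty\},$$ and let $A^0(\Omega)=L^2(\Omega)$ with the $L^2$ norm. For $s\ge 0$ let $H^s(\mathbb R^d)=\{g\in L^2(\mathbb R^d):(1+|\xi|^2)^{s/2}\hat g\in L^2(\mathbb R^d)\}$ with norm $\|(1+|\xi|^2)^{s/2}\hat g\|_{L^2}$, and let $H^s(\Omega)$ be the space of restrictions to $\Omega$ of functions in $H^s(\mathbb R^d)$, with the quotient norm $\|f\|_{H^s(\Omega)}=\inf\{\|g\|_{H^s(\mathbb R^d)}:g|_\Omega=f\}$. Write $X\hookrightarrow Y$ if $X\subset Y$ and the inclusion is bounded. Then: 1. $H^s(\Omega)\hookrightarrow A^r(\Omega)$ whenever $0\le r\le s<1$; 2. $A^r(\Omega)\hookrightarrow H^s(\Omega)$ whenever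 $0\le s<\tfrac12$ and $s\le r$; 3. consequently, $A^r(\Omega)=H^r(\Omega)$ with equivalent norms for $0\le r<\tfrac12$. -/

import Mathlib

open MeasureTheory FourierTransform
open scoped ENNReal NNReal

noncomputable section

/-- The Euclidean space `ℝ^d`. -/
abbrev RSpace (d : ℕ) : Type := EuclideanSpace ℝ (Fin d)

/-- The Hilbert space `L²(ℝ^d)` of complex-valued functions, with respect to Lebesgue measure. -/
abbrev L2Space (d : ℕ) : Type := Lp ℂ 2 (volume : Measure (RSpace d))

/-- The Hilbert space `L²(Ω)` of complex-valued functions, with respect to Lebesgue measure. -/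
abbrev L2On {d : ℕ} (Ω : Set (RSpace d)) : Type := Lp ℂ 2 (volume.restrict Ω)

/-- `Ω ⊆ ℝ^d` (for `d ≥ 1`) has Lipschitz boundary: around every boundary point `x₀` there are
Cartesian coordinates `e (x - x₀) = (y', y_d)` centered at `x₀` in which `Ω` is locally the
part of a cylinder lying above the graph of a Lipschitz function `g`. -/
def HasLipschitzBoundary {d : ℕ} (Ω : Set (RSpace d)) : Prop :=
  ∀ x₀ ∈ frontier Ω, ∃ (ε a : ℝ) (K : ℝ≥0) (g : RSpace (d - 1) → ℝ)
    (e : RSpace d ≃ₗᵢ[ℝ] WithLp 2 (RSpace (d - 1) × ℝ)),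
    0 < ε ∧ 0 < a ∧ LipschitzOnWith K g (Metric.ball 0 ε) ∧ g 0 = 0 ∧
    (∀ y ∈ Metric.ball (0 : RSpace (d - 1)) ε, |g y| < a) ∧
    ∀ x : RSpace d, (e (x - x₀)).fst ∈ Metric.ball (0 : RSpace (d - 1)) ε →
      |(e (x - x₀)).snd| < 2 * a →
      (x ∈ Ω ↔ g (e (x - x₀)).fst < (e (x - x₀)).snd)

/-! ### Fractional Sobolev spaces -/

/-- The norm `‖⟨ξ⟩^s ĝ‖_{L²}` of `H^s(ℝ^d)`, with `⟨ξ⟩ = (1 + |ξ|²)^{1/2}`, where `ĝ` is the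
Fourier transform on `L²(ℝ^d)`; its value is `∞` if `g` is not in `H^s(ℝ^d)`. -/
def sobolevNormRn {d : ℕ} (s : ℝ) (g : L2Space d) : ℝ≥0∞ :=
  eLpNorm (fun ξ : RSpace d => ((1 + ‖ξ‖ ^ 2) ^ (s / 2) : ℝ) • (𝓕 g : L2Space d) ξ) 2 volume

/-- `H^s(ℝ^d)`, as a set of elements of `L²(ℝ^d)`. -/
def sobolevSpaceRn (d : ℕ) (s : ℝ) : Set (L2Space d) := {g | sobolevNormRn s g < ∞}

/-- The function `f` on `Ω` is the restriction to `Ω` of the function `g` on `ℝ^d`. -/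
def IsRestriction {d : ℕ} {Ω : Set (RSpace d)} (g : L2Space d) (f : L2On Ω) : Prop :=
  ⇑g =ᵐ[volume.restrict Ω] ⇑f

/-- `H^s(Ω)`: the restrictions to `Ω` of the functions in `H^s(ℝ^d)`. -/
def sobolevSpace {d : ℕ} (Ω : Set (RSpace d)) (s : ℝ) : Set (L2On Ω) :=
  {f | ∃ g ∈ sobolevSpaceRn d s, IsRestriction g f}

/-- The quotient norm of `H^s(Ω)`. -/
def sobolevNorm {d : ℕ} (Ω : Set (RSpace d)) (s : ℝ) (f : L2On Ω) : ℝ≥0∞ :=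
  ⨅ g ∈ {g : L2Space d | g ∈ sobolevSpaceRn d s ∧ IsRestriction g f}, sobolevNormRn s g

/-! ### Multiscale decompositions

A family `(Ω_{n,k})` with `n ≥ 0` and `0 ≤ k < p^n` is given by `D : ℕ → ℕ → Set (RSpace d)`;
the values `D n k` with `k ≥ p ^ n` play no role. -/

/-- `D` is a `p`-multiscale decomposition of `Ω` (into Lebesgue measurable pieces). -/
structure IsMultiscaleDecomposition {d : ℕ} (p : ℕ) (Ω : Set (RSpace d))
    (D : ℕ → ℕ → Set (RSpace d)) : Prop where
  nullMeasurableSet : ∀ n, ∀ k < p ^ n, NullMeasurableSet (D n k) volume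
  nonempty : ∀ n, ∀ k < p ^ n, (D n k).Nonempty
  subset : ∀ n, ∀ k < p ^ n, D n k ⊆ Ω
  zero_eq : D 0 0 = Ω
  disjoint : ∀ n, ∀ k < p ^ n, ∀ l < p ^ n, k ≠ l → Disjoint (D n k) (D n l)
  child_subset : ∀ n, ∀ k < p ^ n, ∀ j < p, D (n + 1) (p * k + j) ⊆ D n k
  volume_diff : ∀ n, ∀ k < p ^ n, volume (D n k \ ⋃ j < p, D (n + 1) (p * k + j)) = 0

/-- The decomposition is weakly balanced: `|Ω_{n,k}|` is comparable with `|Ω| / p^n`. -/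
def IsWeaklyBalanced {d : ℕ} (p : ℕ) (Ω : Set (RSpace d)) (D : ℕ → ℕ → Set (RSpace d)) : Prop :=
  ∃ C₀ : ℝ, 1 ≤ C₀ ∧ ∀ n, ∀ k < p ^ n,
    1 / C₀ * (volume.real Ω / (p : ℝ) ^ n) ≤ volume.real (D n k) ∧
    volume.real (D n k) ≤ C₀ * (volume.real Ω / (p : ℝ) ^ n)

/-- The decomposition is regular: `diam Ω_{n,k} ≤ c₁ p^{-n/d}` and
`|Ω_{n,k} \ (Ω_{n,k} + h)| ≤ c₂ |h| p^{-n(d-1)/d}`. -/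
def IsRegularDecomposition {d : ℕ} (p : ℕ) (D : ℕ → ℕ → Set (RSpace d)) : Prop :=
  (∃ c₁ : ℝ, 0 < c₁ ∧ ∀ n, ∀ k < p ^ n,
    Metric.diam (D n k) ≤ c₁ * (p : ℝ) ^ (-((n : ℝ) / d))) ∧
  (∃ c₂ : ℝ, 0 < c₂ ∧ ∀ h : RSpace d, ∀ n, ∀ k < p ^ n,
    volume.real (D n k \ ((fun x => x + h) '' D n k))
      ≤ c₂ * ‖h‖ * (p : ℝ) ^ (-((n : ℝ) * ((d : ℝ) - 1) / d)))

/-! ### Approximation spaces -/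

/-- The subspace `V_n` of `L²(Ω)` spanned by the indicator functions of the `Ω_{n,k}`. -/
def pieceSpan {d : ℕ} (p : ℕ) (Ω : Set (RSpace d)) (D : ℕ → ℕ → Set (RSpace d)) (n : ℕ) :
    Submodule ℂ (L2On Ω) :=
  Submodule.span ℂ
    {g | ∃ k < p ^ n, ⇑g =ᵐ[volume.restrict Ω] (D n k).indicator (fun _ => (1 : ℂ))}

instance pieceSpan_finiteDimensional {d : ℕ} (p : ℕ) (Ω : Set (RSpace d))
    (D : ℕ → ℕ → Set (RSpace d)) (n : ℕ) : FiniteDimensional ℂ (pieceSpan p Ω D n) := by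
  refine FiniteDimensional.span_of_finite ℂ ?_
  have h : {g : L2On Ω | ∃ k < p ^ n,
      ⇑g =ᵐ[volume.restrict Ω] (D n k).indicator (fun _ => (1 : ℂ))} =
      ⋃ k ∈ Set.Iio (p ^ n),
        {g : L2On Ω | ⇑g =ᵐ[volume.restrict Ω] (D n k).indicator (fun _ => (1 : ℂ))} := by
    ext g
    simp
  rw [h]
  refine (Set.finite_Iio (p ^ n)).biUnion fun k _ => Set.Subsingleton.finite ?_
  intro g hg g' hg'
  exact Lp.ext (Filter.EventuallyEq.trans hg (Filter.EventuallyEq.symm hg'))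

/-- The orthogonal projector `P_n` of `L²(Ω)` onto `V_n`. -/
def pieceProj {d : ℕ} (p : ℕ) (Ω : Set (RSpace d)) (D : ℕ → ℕ → Set (RSpace d)) (n : ℕ) :
    L2On Ω →L[ℂ] L2On Ω :=
  (pieceSpan p Ω D n).starProjection

/-- The norm of the approximation space `A^r(Ω)`, with value `∞` outside `A^r(Ω)`. For `r > 0` it
is `(‖P_0 f‖² + ∑ₙ (p^{nr/d} ‖f - P_n f‖)²)^{1/2}`; for `r = 0` it is the norm of `L²(Ω)`. -/
def approxNorm {d : ℕ} (p : ℕ) (Ω : Set (RSpace d)) (D : ℕ → ℕ → Set (RSpace d)) (r : ℝ)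
    (f : L2On Ω) : ℝ≥0∞ :=
  if r = 0 then ‖f‖ₑ
  else (‖pieceProj p Ω D 0 f‖ₑ ^ 2 +
    ∑' n : ℕ, (ENNReal.ofReal ((p : ℝ) ^ ((n : ℝ) * r / d)) * ‖f - pieceProj p Ω D n f‖ₑ) ^ 2)
      ^ (1 / 2 : ℝ)

/-- The approximation space `A^r(Ω)`, in particular `A^0(Ω) = L²(Ω)`. -/
def approxSpace {d : ℕ} (p : ℕ) (Ω : Set (RSpace d)) (D : ℕ → ℕ → Set (RSpace d)) (r : ℝ) :
    Set (L2On Ω) :=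
  {f | approxNorm p Ω D r f < ∞}

/-- `X ↪ Y`: the space `X` with norm `NX` is contained in the space `Y` with norm `NY`, and the
inclusion is bounded. -/
def ContinuouslyEmbeds {F : Type*} (X : Set F) (NX : F → ℝ≥0∞) (Y : Set F) (NY : F → ℝ≥0∞) :
    Prop :=
  X ⊆ Y ∧ ∃ C : ℝ≥0, ∀ f ∈ X, NY f ≤ C * NX f

end

/-! Both embeddings compare the errors `‖f - P_n f‖` with the L² modulus of continuity `‖g(· + h) -
g‖` at `|h| ~ q^{-n}`, where `q = p^{1/d}` is the ratio of consecutive length scales. By Plancherel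
this modulus is the integral of `|e^{2πi⟨h,ξ⟩} - 1|² |ĝ(ξ)|²`, so Sobolev norms can be read off from
translations.

From H^s to A^r: let `g` be any function on `ℝ^d` restricting to `f`. On each piece, replace `g` by
its value at a point no worse than average. Since pieces have diameter `O(q^{-n})` and volume
comparable to `q^{-nd}`, the squared error is at most a constant times the largest squared modulus
over `|h| ≤ c q^{-n}` (`enorm_sub_pieceProj_sq_le`). The resulting multiplier is `min(1,
(⟨ξ⟩/q^n)²)`, and its sum over `n` against `q^{2nr}` is `O(⟨ξ⟩^{2r})` for `0 < r < 1`
(`exists_tsum_rpow_mul_min_le`).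

From A^r to H^s: extend `f` by zero. A step function of scale `n` changes under translation only
near the boundaries of its pieces, which gives a squared modulus `O(|h| q^n)‖v‖²`
(`exists_enorm_translateL2_sub_sq_le`). Splitting `f` into the increments `P_n f - P_{n-1} f` up to
scale `j` and a remainder bounds the modulus at scale `j` by `∑_{n ≤ j} q^{(n-j)/2}‖P_n f - P_{n-1}
f‖ + ‖f - P_j f‖`, up to constants. A discrete Hardy inequality sums this against `q^{2js}` because
`q^{s-1/2} < 1` (`tsum_hardy_pieceIncr_le`). Conversely, coordinate shifts at the scales `q^{-j}`
detect all of `⟨ξ⟩^{2s}` (`exists_one_add_norm_sq_rpow_le`). -/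

noncomputable section

/-! ### Translations and the Fourier transform on L². -/

variable {d : ℕ}

/-- Translation of square-integrable functions, `g ↦ g (· + h)`. -/
def translateL2 (h : RSpace d) : L2Space d →ₗᵢ[ℂ] L2Space d :=
  Lp.compMeasurePreservingₗᵢ ℂ (fun x => x + h) (measurePreserving_add_right volume h)

theorem coeFn_translateL2 (h : RSpace d) (g : L2Space d) :
    ⇑(translateL2 h g) =ᵐ[volume] fun x => g (x + h) :=
  Lp.coeFn_compMeasurePreserving g (measurePreserving_add_right volume h)

theorem memLp_top_fourierChar_inner (h : RSpace d) :
    MemLp (fun ξ : RSpace d => ((Real.fourierChar (inner ℝ h ξ) : Circle) : ℂ)) ∞ volume := by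
  refine memLp_top_of_bound (Continuous.aestronglyMeasurable ?_) 1 ?_
  · fun_prop
  · exact Filter.Eventually.of_forall fun ξ => (Circle.norm_coe _).le

/-- Multiplication of square-integrable functions by the character `ξ ↦ e^{2πi⟨h, ξ⟩}`. -/
def modulate (h : RSpace d) : L2Space d →L[ℂ] L2Space d :=
  (ContinuousLinearMap.mul ℂ ℂ).holderL volume ∞ 2 2 (memLp_top_fourierChar_inner h).toLp

theorem coeFn_modulate (h : RSpace d) (g : L2Space d) :
    ⇑(modulate h g) =ᵐ[volume] fun ξ => ((Real.fourierChar (inner ℝ h ξ) : Circle) : ℂ) * g ξ := by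
  filter_upwards [(ContinuousLinearMap.mul ℂ ℂ).coeFn_holder (r := 2)
    ((memLp_top_fourierChar_inner h).toLp) g, (memLp_top_fourierChar_inner h).coeFn_toLp]
    with ξ h1 h2
  rw [← h2]
  exact h1

/-- Both sides are continuous in `g`, so it suffices to check Schwartz functions, where this is a
change of variables in the Fourier integral. -/
theorem fourier_translateL2 (h : RSpace d) (g : L2Space d) :
    𝓕 (translateL2 h g) = modulate h (𝓕 g) := by
  refine DenseRange.induction_on
    (p := fun g : L2Space d => 𝓕 (translateL2 h g) = modulate h (𝓕 g))
    (SchwartzMap.denseRange_toLpCLM (F := ℂ) (p := 2) (μ := (volume : Measure (RSpace d)))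
      ENNReal.ofNat_ne_top) g ?_ ?_
  · exact isClosed_eq
      ((Lp.fourierTransformₗᵢ _ ℂ).continuous.comp (translateL2 h).continuous)
      ((modulate h).continuous.comp (Lp.fourierTransformₗᵢ _ ℂ).continuous)
  · intro φ
    have h1 : translateL2 h (φ.toLp 2) = (φ.compSubConstCLM ℂ (-h)).toLp 2 := by
      refine Lp.ext ?_
      have h2 := (measurePreserving_add_right volume h).quasiMeasurePreserving.ae_eq_comp
        (φ.coeFn_toLp 2 volume)
      filter_upwards [coeFn_translateL2 h (φ.toLp 2), h2,
        (φ.compSubConstCLM ℂ (-h)).coeFn_toLp 2 volume] with x hx hx2 hx3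
      rw [hx, hx3]
      simpa using hx2
    change 𝓕 (translateL2 h (φ.toLp 2)) = modulate h (𝓕 (φ.toLp 2))
    rw [h1, SchwartzMap.toLp_fourier_eq, SchwartzMap.toLp_fourier_eq]
    refine Lp.ext ?_
    filter_upwards [(𝓕 (φ.compSubConstCLM ℂ (-h))).coeFn_toLp 2 volume,
      coeFn_modulate h ((𝓕 φ).toLp 2), (𝓕 φ).coeFn_toLp 2 volume] with ξ h3 h4 h5
    rw [h3, h4, h5, SchwartzMap.fourier_coe, SchwartzMap.fourier_coe]
    have h6 := congrFun (VectorFourier.fourierIntegral_comp_add_right Real.fourierChar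
      (volume : Measure (RSpace d)) (innerₗ (RSpace d)) φ h) ξ
    have h7 : ⇑(φ.compSubConstCLM ℂ (-h)) = ⇑φ ∘ fun v => v + h := by
      ext x; simp
    rw [h7]
    exact h6

theorem enorm_sq_eq_lintegral {μ : Measure (RSpace d)} (g : Lp ℂ 2 μ) :
    ‖g‖ₑ ^ 2 = ∫⁻ x, ‖g x‖ₑ ^ 2 ∂μ := by
  rw [Lp.enorm_def, ← ENNReal.rpow_natCast, eLpNorm_eq_lintegral_rpow_enorm_toReal (by simp) (by simp),
    ← ENNReal.rpow_mul]
  simp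

/-- Plancherel, with translation turned into modulation; this links the modulus of continuity to
Sobolev norms in both directions. -/
theorem enorm_translateL2_sub_sq (h : RSpace d) (g : L2Space d) :
    ‖translateL2 h g - g‖ₑ ^ 2 =
      ∫⁻ ξ, ‖((Real.fourierChar (inner ℝ h ξ) : Circle) : ℂ) - 1‖ₑ ^ 2 * ‖(𝓕 g : L2Space d) ξ‖ₑ ^ 2 := by
  have h1 : ‖translateL2 h g - g‖ₑ = ‖modulate h (𝓕 g) - 𝓕 g‖ₑ := by
    rw [← fourier_translateL2]
    have : 𝓕 (translateL2 h g) - 𝓕 g = (Lp.fourierTransformₗᵢ (RSpace d) ℂ) (translateL2 h g - g) :=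
      ((Lp.fourierTransformₗᵢ (RSpace d) ℂ).map_sub _ _).symm
    rw [this, LinearIsometryEquiv.enorm_map]
  rw [h1, enorm_sq_eq_lintegral]
  refine lintegral_congr_ae ?_
  filter_upwards [coeFn_modulate h (𝓕 g), Lp.coeFn_sub (modulate h (𝓕 g)) (𝓕 g)] with ξ h2 h3
  rw [h3, Pi.sub_apply, h2, ← mul_pow, ← enorm_mul, sub_mul, one_mul]

theorem sobolevNormRn_sq (s : ℝ) (g : L2Space d) :
    sobolevNormRn s g ^ 2 =
      ∫⁻ ξ, ENNReal.ofReal ((1 + ‖ξ‖ ^ 2) ^ s) * ‖(𝓕 g : L2Space d) ξ‖ₑ ^ 2 := by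
  rw [sobolevNormRn, ← ENNReal.rpow_natCast,
    eLpNorm_eq_lintegral_rpow_enorm_toReal (by simp) (by simp), ← ENNReal.rpow_mul]
  simp only [ENNReal.toReal_ofNat, Nat.cast_ofNat, one_div, ne_eq, OfNat.ofNat_ne_zero,
    not_false_eq_true, inv_mul_cancel₀, ENNReal.rpow_one]
  refine lintegral_congr fun ξ => ?_
  have hp : 0 ≤ (1 + ‖ξ‖ ^ 2) ^ (s / 2) := by positivity
  rw [ENNReal.rpow_ofNat, enorm_smul, mul_pow, Real.enorm_of_nonneg hp, ← ENNReal.ofReal_pow hp,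
    ← Real.rpow_natCast, ← Real.rpow_mul (by positivity)]
  norm_num

theorem sobolevNormRn_zero (g : L2Space d) : sobolevNormRn 0 g = ‖g‖ₑ := by
  have h : ‖g‖ₑ = ‖𝓕 g‖ₑ := ((Lp.fourierTransformₗᵢ (RSpace d) ℂ).enorm_map g).symm
  rw [h, Lp.enorm_def]
  simp [sobolevNormRn]

end

/-! ### Elementary inequalities for characters, geometric sums and the Sobolev weight. -/

noncomputable section

theorem norm_fourierChar_sub_one (a : ℝ) :
    ‖((Real.fourierChar a : Circle) : ℂ) - 1‖ = 2 * |Real.sin (Real.pi * a)| := by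
  have h := Complex.norm_exp_I_mul_ofReal_sub_one (x := 2 * Real.pi * a)
  rw [Real.fourierChar_apply, mul_comm _ Complex.I, h, norm_mul, Real.norm_eq_abs, Real.norm_eq_abs,
    abs_of_pos (by norm_num : (0 : ℝ) < 2)]
  ring_nf

theorem norm_fourierChar_sub_one_sq_le (a : ℝ) :
    ‖((Real.fourierChar a : Circle) : ℂ) - 1‖ ^ 2 ≤ 4 * Real.pi ^ 2 * min 1 (a ^ 2) := by
  rw [norm_fourierChar_sub_one, mul_pow, sq_abs]
  have h1 : Real.sin (Real.pi * a) ^ 2 ≤ 1 := Real.sin_sq_le_one _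
  have h2 : Real.sin (Real.pi * a) ^ 2 ≤ (Real.pi * a) ^ 2 := Real.sin_sq_le_sq
  have h3 := Real.pi_gt_three
  rcases min_cases (1 : ℝ) (a ^ 2) with ⟨h, -⟩ | ⟨h, -⟩ <;> rw [h] <;> nlinarith

theorem le_norm_fourierChar_sub_one_sq {a : ℝ} (ha : |a| ≤ 1 / 2) :
    16 * a ^ 2 ≤ ‖((Real.fourierChar a : Circle) : ℂ) - 1‖ ^ 2 := by
  have hpi := Real.pi_pos
  have h1 : 2 / Real.pi * (Real.pi * |a|) ≤ Real.sin (Real.pi * |a|) :=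
    Real.mul_le_sin (by positivity) (by nlinarith)
  have h2 : 2 / Real.pi * (Real.pi * |a|) = 2 * |a| := by field_simp
  have h3 : |Real.sin (Real.pi * a)| = |Real.sin (Real.pi * |a|)| := by
    rcases abs_cases a with ⟨h, -⟩ | ⟨h, -⟩ <;> simp [h]
  rw [norm_fourierChar_sub_one, h3]
  have h4 : 2 * |a| ≤ |Real.sin (Real.pi * |a|)| := by
    rw [← h2]; exact h1.trans (le_abs_self _)
  have h5 : (4 * |a|) ^ 2 ≤ (2 * |Real.sin (Real.pi * |a|)|) ^ 2 :=
    pow_le_pow_left₀ (by positivity) (by linarith) 2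
  rw [mul_pow 4, sq_abs] at h5
  linarith

/-- Split at the scale `q^N ≤ X < q^(N+1)`. Up to `N` the terms are dominated by an increasing
geometric series, which needs `s > 0`; beyond `N` the quadratic factor forces geometric decay, which
needs `s < 1`. -/
theorem exists_tsum_rpow_mul_min_le {q s : ℝ} (hq : 1 < q) (hs : 0 < s) (hs1 : s < 1) :
    ∃ C : ℝ≥0, ∀ X : ℝ, 1 ≤ X →
      ∑' n : ℕ, ENNReal.ofReal ((q ^ n) ^ (2 * s) * min 1 ((X / q ^ n) ^ 2)) ≤
        C * ENNReal.ofReal (X ^ (2 * s)) := by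
  have hq0 : 0 < q := by linarith
  set w : ℝ := q ^ (2 * s) with hw
  have hw1 : 1 < w := Real.one_lt_rpow hq (by linarith)
  set η : ℝ := (q ^ (2 * (1 - s)))⁻¹ with hη
  have hη0 : 0 < η := by positivity
  have hη1 : η < 1 := inv_lt_one_of_one_lt₀ (Real.one_lt_rpow hq (by linarith))
  have hpow : ∀ n : ℕ, (q ^ n) ^ (2 * s) = w ^ n := fun n => by
    rw [hw, ← Real.rpow_natCast, ← Real.rpow_natCast, ← Real.rpow_mul hq0.le,
      ← Real.rpow_mul hq0.le, mul_comm]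
  refine ⟨Real.toNNReal (w / (w - 1)) + Real.toNNReal (1 - η)⁻¹, fun X hX => ?_⟩
  have hX0 : 0 < X := by linarith
  obtain ⟨N, hN1, hN2⟩ := exists_nat_pow_near hX hq
  have hXs : 0 < X ^ (2 * s) := by positivity
  rw [← ENNReal.summable.sum_add_tsum_nat_add' (k := N + 1), ENNReal.coe_add, add_mul]
  refine add_le_add ?_ ?_
  · calc _ ≤ ∑ n ∈ Finset.range (N + 1), ENNReal.ofReal (w ^ n) := by
          refine Finset.sum_le_sum fun n _ => ENNReal.ofReal_le_ofReal ?_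
          rw [hpow]
          exact mul_le_of_le_one_right (by positivity) (min_le_left _ _)
      _ = ENNReal.ofReal (∑ n ∈ Finset.range (N + 1), w ^ n) :=
          (ENNReal.ofReal_sum_of_nonneg fun n _ => by positivity).symm
      _ ≤ ENNReal.ofReal (w / (w - 1) * X ^ (2 * s)) := by
          refine ENNReal.ofReal_le_ofReal ?_
          rw [geom_sum_eq hw1.ne', div_mul_eq_mul_div]
          have h1 : w ^ N ≤ X ^ (2 * s) := by
            rw [← hpow]
            exact Real.rpow_le_rpow (by positivity) hN1 (by linarith)
          have : 0 < w - 1 := by linarith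
          gcongr
          rw [pow_succ]
          nlinarith
      _ = _ := by
          rw [ENNReal.ofReal_mul (div_nonneg (by linarith) (by linarith))]
          rfl
  · calc _ ≤ ∑' m : ℕ, ENNReal.ofReal (X ^ (2 * s)) * ENNReal.ofReal η ^ m := by
          refine ENNReal.tsum_le_tsum fun m => ?_
          rw [← ENNReal.ofReal_pow hη0.le, ← ENNReal.ofReal_mul hXs.le]
          refine ENNReal.ofReal_le_ofReal ?_
          have hy : 0 < q ^ (m + (N + 1)) := by positivity
          set y := q ^ (m + (N + 1)) with hy'
          have h1 : y ^ (2 * s) * (X / y) ^ 2 = X ^ (2 * s) * (X / y) ^ (2 * (1 - s)) := by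
            have h2 : (X / y) ^ 2 = (X / y) ^ (2 * s) * (X / y) ^ (2 * (1 - s)) := by
              rw [← Real.rpow_add (by positivity), ← Real.rpow_natCast]
              congr 1; push_cast; ring
            rw [h2, ← mul_assoc, ← Real.mul_rpow hy.le (by positivity), mul_div_cancel₀ _ hy.ne']
          calc y ^ (2 * s) * min 1 ((X / y) ^ 2) ≤ y ^ (2 * s) * (X / y) ^ 2 := by
                gcongr; exact min_le_right _ _
            _ = X ^ (2 * s) * (X / y) ^ (2 * (1 - s)) := h1
            _ ≤ X ^ (2 * s) * ((q ^ m)⁻¹) ^ (2 * (1 - s)) := by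
                refine mul_le_mul_of_nonneg_left (Real.rpow_le_rpow (by positivity) ?_ (by linarith))
                  hXs.le
                rw [div_le_iff₀ hy, hy', pow_add, ← mul_assoc, inv_mul_cancel₀ (by positivity),
                  one_mul]
                exact hN2.le
            _ = X ^ (2 * s) * η ^ m := by
                congr 1
                rw [hη, inv_pow, Real.inv_rpow (by positivity), ← Real.rpow_natCast,
                  ← Real.rpow_natCast, ← Real.rpow_mul hq0.le, ← Real.rpow_mul hq0.le, mul_comm]
      _ = _ := by
          rw [ENNReal.tsum_mul_left, ENNReal.tsum_geometric, mul_comm]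
          congr 1
          rw [← ENNReal.ofReal_one, ← ENNReal.ofReal_sub _ hη0.le,
            ← ENNReal.ofReal_inv_of_pos (by linarith)]
          rfl

/-- The recursive form of Young's inequality for convolution with `θ^n`, and the source of the Hardy
inequality below. -/
theorem sum_sq_le_of_contraction {θ : ℝ} (hθ0 : 0 ≤ θ) (hθ : θ < 1) {S b : ℕ → ℝ}
    (hS : ∀ j, 0 ≤ S j) (h0 : S 0 ≤ b 0) (h : ∀ j, S (j + 1) ≤ θ * S j + b (j + 1)) (J : ℕ) :
    (1 - θ) ^ 2 * ∑ j ∈ Finset.range J, S j ^ 2 ≤ ∑ j ∈ Finset.range J, b j ^ 2 := by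
  -- The extra term in `S J ^ 2` makes the induction close: convexity of the square bounds `(1 - θ)
  -- * S (J + 1) ^ 2` by exactly this term plus `b (J + 1) ^ 2`, and `(1 - θ) ^ 2 + (1 - θ) * θ = 1
  -- - θ`.
  have key : ∀ J, (1 - θ) ^ 2 * ∑ j ∈ Finset.range (J + 1), S j ^ 2 + (1 - θ) * θ * S J ^ 2 ≤
      ∑ j ∈ Finset.range (J + 1), b j ^ 2 := by
    intro J
    induction J with
    | zero =>
      simp only [zero_add, Finset.sum_range_one]
      have h1 : S 0 ^ 2 ≤ b 0 ^ 2 := pow_le_pow_left₀ (hS 0) h0 2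
      nlinarith [sq_nonneg (S 0)]
    | succ J ih =>
      rw [Finset.sum_range_succ, Finset.sum_range_succ _ (J + 1)]
      have h1 : S (J + 1) ^ 2 ≤ (θ * S J + b (J + 1)) ^ 2 := pow_le_pow_left₀ (hS _) (h J) 2
      have h2 : (1 - θ) * (θ * S J + b (J + 1)) ^ 2 ≤ (1 - θ) * θ * S J ^ 2 + b (J + 1) ^ 2 := by
        have : (1 - θ) * θ * S J ^ 2 + b (J + 1) ^ 2 - (1 - θ) * (θ * S J + b (J + 1)) ^ 2 =
          θ * ((1 - θ) * S J - b (J + 1)) ^ 2 := by ring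
        nlinarith [mul_nonneg hθ0 (sq_nonneg ((1 - θ) * S J - b (J + 1)))]
      nlinarith
  rcases J with _ | J
  · simp
  · have := key J
    have h3 : 0 ≤ (1 - θ) * θ * S J ^ 2 :=
      mul_nonneg (mul_nonneg (by linarith) hθ0) (sq_nonneg _)
    linarith

/-- For `|ξ| < 1` the summand `1` suffices. Otherwise a single scale `j` does, the one with `q^(j-1)
≤ |ξ| < q^j`. The factor `1/2` in the shifts keeps each phase in `[-1/2, 1/2]`, where `|e^{2πia} -
1|` is bounded below linearly. -/
theorem exists_one_add_norm_sq_rpow_le {d : ℕ} {q s : ℝ} (hq : 1 < q) (hs : 0 ≤ s) :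
    ∃ C : ℝ≥0, ∀ ξ : RSpace d, ENNReal.ofReal ((1 + ‖ξ‖ ^ 2) ^ s) ≤
      C * (1 + ∑' j : ℕ, ENNReal.ofReal ((q ^ j) ^ (2 * s)) * ∑ i : Fin d,
        ‖((Real.fourierChar (inner ℝ (EuclideanSpace.single i ((q ^ j)⁻¹ / 2) : RSpace d) ξ) :
          Circle) : ℂ) - 1‖ₑ ^ 2) := by
  have hq0 : 0 < q := by linarith
  refine ⟨Real.toNNReal (2 ^ s * q ^ 2), fun ξ => ?_⟩
  have hC : (1 : ℝ) ≤ q ^ 2 := one_le_pow₀ hq.le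
  change _ ≤ ENNReal.ofReal (2 ^ s * q ^ 2) * _
  rcases lt_or_ge ‖ξ‖ 1 with hξ | hξ
  · calc _ ≤ ENNReal.ofReal (2 ^ s * q ^ 2) * 1 := by
          rw [mul_one]
          refine ENNReal.ofReal_le_ofReal ?_
          calc (1 + ‖ξ‖ ^ 2) ^ s ≤ 2 ^ s := by
                gcongr
                nlinarith [norm_nonneg ξ]
            _ ≤ 2 ^ s * q ^ 2 := le_mul_of_one_le_right (by positivity) hC
      _ ≤ _ := by gcongr; exact le_self_add
  · obtain ⟨N, hN1, hN2⟩ := exists_nat_pow_near hξ hq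
    refine le_trans ?_ (mul_le_mul_right (le_add_left (ENNReal.le_tsum (N + 1))) _)
    have h1 : ENNReal.ofReal (16 * ((q ^ (N + 1))⁻¹ / 2) ^ 2 * ‖ξ‖ ^ 2) ≤ ∑ i : Fin d,
        ‖((Real.fourierChar (inner ℝ (EuclideanSpace.single i ((q ^ (N + 1))⁻¹ / 2) :
          RSpace d) ξ) : Circle) : ℂ) - 1‖ₑ ^ 2 := by
      rw [EuclideanSpace.norm_sq_eq, Finset.mul_sum,
        ENNReal.ofReal_sum_of_nonneg fun i _ => by positivity]
      refine Finset.sum_le_sum fun i _ => ?_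
      rw [EuclideanSpace.inner_single_left, ← ofReal_norm,
        ← ENNReal.ofReal_pow (norm_nonneg _)]
      refine ENNReal.ofReal_le_ofReal ?_
      have h2 : |(q ^ (N + 1))⁻¹ / 2 * ξ i| ≤ 1 / 2 := by
        rw [abs_mul, abs_of_pos (by positivity)]
        have h3 : |ξ i| ≤ q ^ (N + 1) := (PiLp.norm_apply_le ξ i).trans hN2.le
        calc _ ≤ (q ^ (N + 1))⁻¹ / 2 * q ^ (N + 1) := by gcongr
          _ = 1 / 2 := by field_simp
      have h4 := le_norm_fourierChar_sub_one_sq h2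
      rw [mul_pow, ← mul_assoc] at h4
      simpa using h4
    refine le_trans ?_ (mul_le_mul_right (mul_le_mul_right h1 _) _)
    rw [← ENNReal.ofReal_mul (by positivity), ← ENNReal.ofReal_mul (by positivity)]
    refine ENNReal.ofReal_le_ofReal ?_
    have h5 : (1 + ‖ξ‖ ^ 2) ^ s ≤ 2 ^ s * (q ^ (N + 1)) ^ (2 * s) := by
      rw [Real.rpow_mul (by positivity), ← Real.mul_rpow (by positivity) (by positivity)]
      refine Real.rpow_le_rpow (by positivity) ?_ hs
      have : ‖ξ‖ ^ 2 ≤ (q ^ (N + 1)) ^ 2 := pow_le_pow_left₀ (norm_nonneg _) hN2.le 2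
      rw [Real.rpow_two]
      nlinarith
    have h6 : 1 ≤ q ^ 2 * (16 * ((q ^ (N + 1))⁻¹ / 2) ^ 2 * ‖ξ‖ ^ 2) := by
      have h8 : (q ^ N) ^ 2 ≤ ‖ξ‖ ^ 2 := pow_le_pow_left₀ (by positivity) hN1 2
      calc (1 : ℝ) ≤ q ^ 2 * (16 * ((q ^ (N + 1))⁻¹ / 2) ^ 2 * (q ^ N) ^ 2) := by
            rw [pow_succ q N]
            have h7 : q ^ 2 * (16 * ((q ^ N * q)⁻¹ / 2) ^ 2 * (q ^ N) ^ 2) = 4 := by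
              field_simp
              norm_num
            rw [h7]
            norm_num
        _ ≤ _ := by gcongr
    calc (1 + ‖ξ‖ ^ 2) ^ s ≤ 2 ^ s * (q ^ (N + 1)) ^ (2 * s) * 1 := by rwa [mul_one]
      _ ≤ 2 ^ s * (q ^ (N + 1)) ^ (2 * s) *
          (q ^ 2 * (16 * ((q ^ (N + 1))⁻¹ / 2) ^ 2 * ‖ξ‖ ^ 2)) := by gcongr
      _ = _ := by ring

end

/-! ### Step functions, the nested spaces V_n and their projectors. -/

noncomputable section

variable {d : ℕ}

theorem ENNReal.le_sqrt_mul_of_sq_le {a b : ℝ≥0∞} {C : ℝ≥0} (h : a ^ 2 ≤ C * b ^ 2) :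
    a ≤ NNReal.sqrt C * b := by
  have h1 : ((NNReal.sqrt C : ℝ≥0) : ℝ≥0∞) ^ 2 = C := by
    rw [← ENNReal.coe_pow, NNReal.sq_sqrt]
  rw [← ENNReal.pow_le_pow_left_iff two_ne_zero, mul_pow, h1]
  exact h

theorem natCast_rpow_mul_div (p : ℕ) (d : ℕ) (n : ℕ) (r : ℝ) :
    (p : ℝ) ^ ((n : ℝ) * r / d) = (((p : ℝ) ^ (1 / (d : ℝ))) ^ n) ^ r := by
  rw [← Real.rpow_natCast, ← Real.rpow_mul (by positivity), ← Real.rpow_mul (by positivity)]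
  congr 1
  ring

/-- The step function with value `a k` on the set `S k`, for `k < N`. -/
def stepFun (S : ℕ → Set (RSpace d)) (N : ℕ) (a : ℕ → ℂ) : RSpace d → ℂ := fun x =>
  ∑ k ∈ Finset.range N, (S k).indicator (fun _ => a k) x

theorem stepFun_of_mem {S : ℕ → Set (RSpace d)} {N : ℕ} {a : ℕ → ℂ}
    (hS : ∀ k < N, ∀ l < N, k ≠ l → Disjoint (S k) (S l)) {k : ℕ} (hk : k < N) {x : RSpace d}
    (hx : x ∈ S k) : stepFun S N a x = a k := by
  rw [stepFun, Finset.sum_eq_single k]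
  · simp [hx]
  · intro l hl hlk
    exact Set.indicator_of_notMem
      (fun hxl => Set.disjoint_left.1 (hS l (Finset.mem_range.1 hl) k hk hlk) hxl hx) _
  · intro h
    exact absurd (Finset.mem_range.2 hk) h

theorem stepFun_of_notMem {S : ℕ → Set (RSpace d)} {N : ℕ} {a : ℕ → ℂ} {x : RSpace d}
    (hx : ∀ k < N, x ∉ S k) : stepFun S N a x = 0 :=
  Finset.sum_eq_zero fun k hk => Set.indicator_of_notMem (hx k (Finset.mem_range.1 hk)) _

section Decomposition

variable {p : ℕ} {Ω : Set (RSpace d)} {D : ℕ → ℕ → Set (RSpace d)}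

theorem exists_mem_pieceSpan_eq_stepFun (hD : IsMultiscaleDecomposition p Ω D)
    (hΩ : volume Ω ≠ ∞) (n : ℕ) (a : ℕ → ℂ) :
    ∃ v ∈ pieceSpan p Ω D n, ⇑v =ᵐ[volume.restrict Ω] stepFun (D n) (p ^ n) a := by
  have : IsFiniteMeasure (volume.restrict Ω) := ⟨by simpa using hΩ.lt_top⟩
  have h1 : ∀ k : ℕ, ∃ u : L2On Ω, k < p ^ n →
      ⇑u =ᵐ[volume.restrict Ω] (D n k).indicator (fun _ => (1 : ℂ)) := by
    intro k
    by_cases hk : k < p ^ n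
    · have hm : MemLp ((D n k).indicator (fun _ => (1 : ℂ))) 2 (volume.restrict Ω) := by
        refine MemLp.of_bound (aestronglyMeasurable_const.indicator₀
          ((hD.nullMeasurableSet n k hk).mono_ac Measure.restrict_le_self.absolutelyContinuous)) 1
          (Filter.Eventually.of_forall fun x => ?_)
        by_cases hx : x ∈ D n k <;> simp [hx]
      exact ⟨hm.toLp, fun _ => hm.coeFn_toLp⟩
    -- A dummy value: nothing is assumed about the sets with index `k ≥ p ^ n`.
    · exact ⟨0, fun h => absurd h hk⟩
  choose u hu using h1
  refine ⟨∑ k ∈ Finset.range (p ^ n), a k • u k, Submodule.sum_mem _ fun k hk =>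
    Submodule.smul_mem _ _ (Submodule.subset_span ⟨k, Finset.mem_range.1 hk,
      hu k (Finset.mem_range.1 hk)⟩), ?_⟩
  have h2 : ∀ k ∈ Finset.range (p ^ n), ∀ᵐ x ∂volume.restrict Ω,
      (a k • u k : L2On Ω) x = (D n k).indicator (fun _ => a k) x := by
    intro k hk
    filter_upwards [Lp.coeFn_smul (a k) (u k), hu k (Finset.mem_range.1 hk)] with x h3 h4
    rw [h3, Pi.smul_apply, h4]
    by_cases hx : x ∈ D n k <;> simp [hx]
  have h3 := (Finset.eventually_all _).2 h2
  filter_upwards [h3, Lp.coeFn_finsetSum (Finset.range (p ^ n)) fun k => a k • u k] with x h4 h5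
  rw [h5, Finset.sum_apply]
  exact Finset.sum_congr rfl h4

theorem exists_eq_stepFun_of_mem_pieceSpan {n : ℕ} {v : L2On Ω} (hv : v ∈ pieceSpan p Ω D n) :
    ∃ a : ℕ → ℂ, ⇑v =ᵐ[volume.restrict Ω] stepFun (D n) (p ^ n) a := by
  induction hv using Submodule.span_induction with
  | mem v hv =>
    obtain ⟨k, hk, hv⟩ := hv
    refine ⟨Pi.single k 1, hv.trans (Filter.Eventually.of_forall fun x => ?_)⟩
    rw [stepFun, Finset.sum_eq_single k]
    · simp
    · intro l _ hl
      simp [Pi.single_eq_of_ne hl]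
    · intro h
      exact absurd (Finset.mem_range.2 hk) h
  | zero =>
    refine ⟨0, (Lp.coeFn_zero _ _ _).trans (Filter.Eventually.of_forall fun x => ?_)⟩
    simp [stepFun]
  | add u v _ _ hu hv =>
    obtain ⟨a, ha⟩ := hu
    obtain ⟨b, hb⟩ := hv
    refine ⟨a + b, ?_⟩
    filter_upwards [Lp.coeFn_add u v, ha, hb] with x h1 h2 h3
    rw [h1, Pi.add_apply, h2, h3, stepFun, stepFun, stepFun, ← Finset.sum_add_distrib]
    refine Finset.sum_congr rfl fun k _ => ?_
    by_cases hx : x ∈ D n k <;> simp [hx]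
  | smul c v _ hv =>
    obtain ⟨a, ha⟩ := hv
    refine ⟨c • a, ?_⟩
    filter_upwards [Lp.coeFn_smul c v, ha] with x h1 h2
    rw [h1, Pi.smul_apply, h2, stepFun, stepFun, Finset.smul_sum]
    refine Finset.sum_congr rfl fun k _ => ?_
    by_cases hx : x ∈ D n k <;> simp [hx]

theorem IsMultiscaleDecomposition.mul_add_lt {n k j : ℕ} (hk : k < p ^ n) (hj : j < p) :
    p * k + j < p ^ (n + 1) := by
  calc p * k + j < p * k + p := by omega
    _ = p * (k + 1) := by ring
    _ ≤ p * p ^ n := Nat.mul_le_mul_left _ hk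
    _ = p ^ (n + 1) := by ring

theorem IsMultiscaleDecomposition.volume_diff_iUnion (hD : IsMultiscaleDecomposition p Ω D)
    (n : ℕ) : volume (Ω \ ⋃ k ∈ Finset.range (p ^ n), D n k) = 0 := by
  induction n with
  | zero => simp [hD.zero_eq]
  | succ n ih =>
    have h1 : volume (⋃ k ∈ Finset.range (p ^ n),
        (D n k \ ⋃ j < p, D (n + 1) (p * k + j))) = 0 := by
      refine (measure_biUnion_null_iff (Finset.countable_toSet _)).2 fun k hk => ?_
      exact hD.volume_diff n k (by simpa using hk)
    refine measure_mono_null ?_ (measure_union_null ih h1)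
    rintro x ⟨hx, hx2⟩
    by_cases h : x ∈ ⋃ k ∈ Finset.range (p ^ n), D n k
    · right
      simp only [Set.mem_iUnion, Finset.mem_range, exists_prop] at h hx2 ⊢
      obtain ⟨k, hk, hxk⟩ := h
      refine ⟨k, hk, hxk, ?_⟩
      simp only [Set.mem_iUnion, exists_prop]
      rintro ⟨j, hj, hxj⟩
      exact hx2 ⟨p * k + j, mul_add_lt hk hj, hxj⟩
    · exact Or.inl ⟨hx, h⟩

/-- A piece is, up to a null set, the union of its children, and the parent of the piece with index
`l` has index `l / p`. -/
theorem pieceSpan_le_succ (hD : IsMultiscaleDecomposition p Ω D) (hΩ : volume Ω ≠ ∞) (n : ℕ) :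
    pieceSpan p Ω D n ≤ pieceSpan p Ω D (n + 1) := by
  refine Submodule.span_le.2 ?_
  rintro u ⟨k, hk, hu⟩
  obtain ⟨v, hv, hv2⟩ := exists_mem_pieceSpan_eq_stepFun hD hΩ (n + 1)
    (fun l => if l / p = k then 1 else 0)
  have huv : u = v := by
    refine Lp.ext ?_
    have h1 : ∀ᵐ x ∂(volume.restrict Ω), x ∉ Ω \ ⋃ k ∈ Finset.range (p ^ (n + 1)), D (n + 1) k :=
      ae_restrict_of_ae (measure_eq_zero_iff_ae_notMem.1 (hD.volume_diff_iUnion (n + 1)))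
    have h1' : ∀ᵐ x ∂(volume.restrict Ω), x ∈ Ω := by
      have := hD.nullMeasurableSet 0 0 (by simp)
      rw [hD.zero_eq] at this
      exact ae_restrict_mem₀ this
    filter_upwards [hu, hv2, h1, h1'] with x h2 h3 h4 hxΩ
    rw [h2, h3]
    have h5 : x ∈ ⋃ k ∈ Finset.range (p ^ (n + 1)), D (n + 1) k := by
      by_contra h
      exact h4 ⟨hxΩ, h⟩
    simp only [Set.mem_iUnion, Finset.mem_range, exists_prop] at h5
    obtain ⟨l, hl, hxl⟩ := h5
    rw [stepFun_of_mem (hD.disjoint (n + 1)) hl hxl]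
    have hp : 0 < p := by
      rcases Nat.eq_zero_or_pos p with rfl | h
      · simp at hl
      · exact h
    have hlp : l / p < p ^ n := by
      rw [Nat.div_lt_iff_lt_mul hp]
      rwa [pow_succ] at hl
    have hxn : x ∈ D n (l / p) := by
      have := hD.child_subset n (l / p) hlp (l % p) (Nat.mod_lt _ hp)
      rw [Nat.div_add_mod] at this
      exact this hxl
    by_cases hlk : l / p = k
    · subst hlk
      simp [hxn]
    · have hxk : x ∉ D n k :=
        fun h => Set.disjoint_left.1 (hD.disjoint n _ hlp k hk hlk) hxn h
      simp [hxk, hlk]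
  rw [huv]
  exact hv

theorem enorm_sub_pieceProj_le {n : ℕ} {f v : L2On Ω} (hv : v ∈ pieceSpan p Ω D n) :
    ‖f - pieceProj p Ω D n f‖ₑ ≤ ‖f - v‖ₑ := by
  rw [← ofReal_norm, ← ofReal_norm]
  refine ENNReal.ofReal_le_ofReal ?_
  rw [pieceProj, Submodule.starProjection_minimal]
  exact ciInf_le (f := fun x : pieceSpan p Ω D n => ‖f - x‖)
    ⟨0, by rintro _ ⟨_, rfl⟩; exact norm_nonneg _⟩ ⟨v, hv⟩

theorem norm_pieceProj_le (n : ℕ) (f : L2On Ω) : ‖pieceProj p Ω D n f‖ ≤ ‖f‖ := by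
  have := (pieceProj p Ω D n).le_opNorm f
  refine this.trans (mul_le_of_le_one_left (norm_nonneg _) ?_)
  exact Submodule.starProjection_norm_le _

theorem pieceProj_mem (n : ℕ) (f : L2On Ω) : pieceProj p Ω D n f ∈ pieceSpan p Ω D n :=
  Submodule.starProjection_apply_mem _ _

/-- Nestedness makes the increment equal to `P_{n+1} (f - P_n f)`, and projectors are contractions.
-/
theorem norm_pieceProj_succ_sub_le (hD : IsMultiscaleDecomposition p Ω D) (hΩ : volume Ω ≠ ∞)
    (n : ℕ) (f : L2On Ω) :
    ‖pieceProj p Ω D (n + 1) f - pieceProj p Ω D n f‖ ≤ ‖f - pieceProj p Ω D n f‖ := by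
  have h1 : pieceProj p Ω D (n + 1) (pieceProj p Ω D n f) = pieceProj p Ω D n f :=
    Submodule.starProjection_eq_self_iff.2 (pieceSpan_le_succ hD hΩ n (pieceProj_mem n f))
  have h2 : pieceProj p Ω D (n + 1) f - pieceProj p Ω D n f =
      pieceProj p Ω D (n + 1) (f - pieceProj p Ω D n f) := by
    rw [map_sub, h1]
  rw [h2]
  exact norm_pieceProj_le _ _

end Decomposition

end

/-! ### The direct (Jackson) estimate: Sobolev regularity controls approximation errors. -/

noncomputable section

variable {d : ℕ} {p : ℕ} {Ω : Set (RSpace d)} {D : ℕ → ℕ → Set (RSpace d)}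

theorem setLIntegral_closedBall_eq {F : RSpace d → ℝ≥0∞} (y : RSpace d) (δ : ℝ) :
    ∫⁻ x in Metric.closedBall y δ, F x = ∫⁻ h in Metric.closedBall 0 δ, F (y + h) := by
  rw [← lintegral_indicator Metric.isClosed_closedBall.measurableSet,
    ← lintegral_indicator Metric.isClosed_closedBall.measurableSet,
    ← lintegral_add_left_eq_self _ y]
  refine lintegral_congr fun h => ?_
  by_cases hh : ‖h‖ ≤ δ <;> simp [Set.indicator, hh]

/-- Substitute `x = y + h` and use Tonelli: for fixed `h` the integral over `y` is the squared
modulus of continuity. -/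
theorem lintegral_setLIntegral_closedBall_le (g : L2Space d) (δ : ℝ) {B : ℝ≥0∞}
    (hB : ∀ h : RSpace d, ‖h‖ ≤ δ → ‖translateL2 h g - g‖ₑ ^ 2 ≤ B) :
    ∫⁻ y, ∫⁻ x in Metric.closedBall y δ, ‖g x - g y‖ₑ ^ 2 ≤
      B * volume (Metric.closedBall (0 : RSpace d) δ) := by
  have hg := (Lp.stronglyMeasurable g).measurable
  rw [lintegral_congr fun y => setLIntegral_closedBall_eq (F := fun x => ‖g x - g y‖ₑ ^ 2) y δ,
    lintegral_lintegral_swap]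
  · rw [← setLIntegral_const]
    refine setLIntegral_mono' Metric.isClosed_closedBall.measurableSet fun h hh => ?_
    refine le_trans (le_of_eq ?_) (hB h (by simpa using hh))
    rw [enorm_sq_eq_lintegral]
    refine lintegral_congr_ae ?_
    filter_upwards [coeFn_translateL2 h g, Lp.coeFn_sub (translateL2 h g) g] with x h1 h2
    rw [h2, Pi.sub_apply, h1]
  · refine Measurable.aemeasurable ?_
    simp only [Function.uncurry_def]
    fun_prop

/-- Piecewise constant approximation by values of the function at well-chosen points. -/
theorem enorm_sub_pieceProj_sq_le_sum (hD : IsMultiscaleDecomposition p Ω D)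
    (hΩ : volume Ω ≠ ∞) (hpos : ∀ n, ∀ k < p ^ n, volume (D n k) ≠ 0)
    {g : L2Space d} {f : L2On Ω} (hgf : IsRestriction g f) (n : ℕ) :
    ‖f - pieceProj p Ω D n f‖ₑ ^ 2 ≤ ∑ k ∈ Finset.range (p ^ n),
      (volume (D n k))⁻¹ * ∫⁻ y in D n k, ∫⁻ x in D n k, ‖g x - g y‖ₑ ^ 2 := by
  have hg := (Lp.stronglyMeasurable g).measurable
  have h1 : ∀ k : ℕ, ∃ y : RSpace d, k < p ^ n → ∫⁻ x in D n k, ‖g x - g y‖ₑ ^ 2 ≤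
      (volume (D n k))⁻¹ * ∫⁻ y in D n k, ∫⁻ x in D n k, ‖g x - g y‖ₑ ^ 2 := by
    intro k
    by_cases hk : k < p ^ n
    · have hfin : volume (D n k) ≠ ∞ := measure_ne_top_of_subset (hD.subset n k hk) hΩ
      -- Some `y` makes the inner integral at most its mean over the piece; `g y` becomes the
      -- constant there.
      obtain ⟨y, -, hy⟩ := exists_le_setLAverage (μ := volume) (s := D n k)
        (f := fun y => ∫⁻ x in D n k, ‖g x - g y‖ₑ ^ 2) (hpos n k hk) hfin (by
          refine Measurable.aemeasurable ?_
          exact Measurable.lintegral_prod_left' (f := fun z : RSpace d × RSpace d =>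
            ‖g z.1 - g z.2‖ₑ ^ 2) (by fun_prop))
      refine ⟨y, fun _ => hy.trans (le_of_eq ?_)⟩
      rw [setLAverage_eq, ENNReal.div_eq_inv_mul]
    · exact ⟨0, fun h => absurd h hk⟩
  choose y hy using h1
  obtain ⟨v, hv, hv2⟩ := exists_mem_pieceSpan_eq_stepFun hD hΩ n (fun k => g (y k))
  calc ‖f - pieceProj p Ω D n f‖ₑ ^ 2 ≤ ‖f - v‖ₑ ^ 2 := by
        gcongr; exact enorm_sub_pieceProj_le hv
    _ = ∫⁻ x in Ω, ‖g x - stepFun (D n) (p ^ n) (fun k => g (y k)) x‖ₑ ^ 2 := by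
        rw [enorm_sq_eq_lintegral]
        refine lintegral_congr_ae ?_
        filter_upwards [hgf, hv2, Lp.coeFn_sub f v] with x h1 h2 h3
        rw [h3, Pi.sub_apply, ← h1, h2]
    _ ≤ ∫⁻ x in ⋃ k ∈ Finset.range (p ^ n), D n k,
          ‖g x - stepFun (D n) (p ^ n) (fun k => g (y k)) x‖ₑ ^ 2 :=
        lintegral_mono_set' (by
          filter_upwards [measure_eq_zero_iff_ae_notMem.1 (hD.volume_diff_iUnion n)] with x hx hxΩ
          by_contra h
          exact hx ⟨hxΩ, h⟩)
    _ = ∑ k ∈ Finset.range (p ^ n), ∫⁻ x in D n k,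
          ‖g x - stepFun (D n) (p ^ n) (fun k => g (y k)) x‖ₑ ^ 2 :=
        lintegral_biUnion_finset₀
          (fun k hk l hl hkl => (hD.disjoint n k (by simpa using hk) l (by simpa using hl)
            hkl).aedisjoint)
          (fun k hk => hD.nullMeasurableSet n k (Finset.mem_range.1 hk)) _
    _ ≤ _ := by
        refine Finset.sum_le_sum fun k hk => ?_
        have hk' := Finset.mem_range.1 hk
        refine le_trans (le_of_eq ?_) (hy k hk')
        refine lintegral_congr_ae ?_
        filter_upwards [ae_restrict_mem₀ (hD.nullMeasurableSet n k hk')] with x hx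
        rw [stepFun_of_mem (hD.disjoint n) hk' hx]

/-- Each piece lies in the ball of radius `δ` about any of its points. After this enlargement the
inner domain no longer depends on the piece, so the disjoint pieces can be summed and the outer
integral extended to the whole space. -/
theorem enorm_sub_pieceProj_sq_le (hD : IsMultiscaleDecomposition p Ω D)
    (hΩ : volume Ω ≠ ∞) (hΩb : Bornology.IsBounded Ω) {n : ℕ} {K B : ℝ≥0∞} {δ : ℝ}
    (hvol : ∀ k < p ^ n, (volume (D n k))⁻¹ ≤ K) (hpos : ∀ n, ∀ k < p ^ n, volume (D n k) ≠ 0)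
    (hdiam : ∀ k < p ^ n, Metric.diam (D n k) ≤ δ)
    {g : L2Space d} {f : L2On Ω} (hgf : IsRestriction g f)
    (hB : ∀ h : RSpace d, ‖h‖ ≤ δ → ‖translateL2 h g - g‖ₑ ^ 2 ≤ B) :
    ‖f - pieceProj p Ω D n f‖ₑ ^ 2 ≤
      K * (B * volume (Metric.closedBall (0 : RSpace d) δ)) := by
  calc _ ≤ ∑ k ∈ Finset.range (p ^ n),
        (volume (D n k))⁻¹ * ∫⁻ y in D n k, ∫⁻ x in D n k, ‖g x - g y‖ₑ ^ 2 :=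
        enorm_sub_pieceProj_sq_le_sum hD hΩ hpos hgf n
    _ ≤ ∑ k ∈ Finset.range (p ^ n),
        K * ∫⁻ y in D n k, ∫⁻ x in Metric.closedBall y δ, ‖g x - g y‖ₑ ^ 2 := by
        refine Finset.sum_le_sum fun k hk => ?_
        have hk' := Finset.mem_range.1 hk
        refine mul_le_mul' (hvol k hk') (lintegral_mono_ae ?_)
        filter_upwards [ae_restrict_mem₀ (hD.nullMeasurableSet n k hk')] with y hy
        refine lintegral_mono_set fun x hx => ?_
        -- Boundedness matters: `Metric.diam` is `0` on unbounded sets.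
        exact (Metric.dist_le_diam_of_mem (hΩb.subset (hD.subset n k hk')) hx hy).trans
          (hdiam k hk')
    _ = K * ∫⁻ y in ⋃ k ∈ Finset.range (p ^ n), D n k,
          ∫⁻ x in Metric.closedBall y δ, ‖g x - g y‖ₑ ^ 2 := by
        rw [← Finset.mul_sum, lintegral_biUnion_finset₀
          (fun k hk l hl hkl => (hD.disjoint n k (by simpa using hk) l (by simpa using hl)
            hkl).aedisjoint)
          (fun k hk => hD.nullMeasurableSet n k (Finset.mem_range.1 hk))]
    _ ≤ K * ∫⁻ y, ∫⁻ x in Metric.closedBall y δ, ‖g x - g y‖ₑ ^ 2 := by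
        gcongr
        exact Measure.restrict_le_self
    _ ≤ _ := by
        gcongr
        exact lintegral_setLIntegral_closedBall_le g δ hB

theorem enorm_translateL2_sub_sq_le {c : ℝ} (g : L2Space d) {y : ℝ} (hy : 0 < y) {h : RSpace d}
    (hc : 1 ≤ c) (hh : ‖h‖ ≤ c / y) :
    ‖translateL2 h g - g‖ₑ ^ 2 ≤ ENNReal.ofReal (4 * Real.pi ^ 2 * c ^ 2) *
      ∫⁻ ξ, ENNReal.ofReal (min 1 (((1 + ‖ξ‖ ^ 2) ^ (1 / 2 : ℝ) / y) ^ 2)) *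
        ‖(𝓕 g : L2Space d) ξ‖ₑ ^ 2 := by
  rw [enorm_translateL2_sub_sq, ← lintegral_const_mul' _ _ ENNReal.ofReal_ne_top]
  refine lintegral_mono fun ξ => ?_
  rw [← mul_assoc, ← ENNReal.ofReal_mul (by positivity)]
  gcongr
  rw [← ofReal_norm, ← ENNReal.ofReal_pow (norm_nonneg _)]
  refine ENNReal.ofReal_le_ofReal ((norm_fourierChar_sub_one_sq_le _).trans ?_)
  rw [mul_assoc (4 * Real.pi ^ 2)]
  gcongr
  have h1 : (((1 + ‖ξ‖ ^ 2) ^ (1 / 2 : ℝ) / y) ^ 2) = (1 + ‖ξ‖ ^ 2) / y ^ 2 := by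
    rw [div_pow, ← Real.rpow_natCast _ 2, ← Real.rpow_mul (by positivity)]
    norm_num
  rw [h1]
  have h2 : (inner ℝ h ξ) ^ 2 ≤ c ^ 2 * ((1 + ‖ξ‖ ^ 2) / y ^ 2) := by
    calc (inner ℝ h ξ) ^ 2 ≤ (‖h‖ * ‖ξ‖) ^ 2 := sq_le_sq' (by
            have := neg_abs_le (inner ℝ h ξ : ℝ)
            have := abs_real_inner_le_norm h ξ
            linarith) (real_inner_le_norm h ξ)
      _ ≤ (c / y) ^ 2 * (1 + ‖ξ‖ ^ 2) := by
          rw [mul_pow]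
          gcongr
          linarith
      _ = _ := by ring
  rw [mul_min_of_nonneg _ _ (by positivity)]
  exact min_le_min (by rw [mul_one]; exact one_le_pow₀ hc) h2

theorem volume_real_pos (hΩ_open : IsOpen Ω) (hΩb : Bornology.IsBounded Ω)
    (hD : IsMultiscaleDecomposition p Ω D) : 0 < volume.real Ω := by
  have hne : Ω.Nonempty := hD.zero_eq ▸ hD.nonempty 0 0 (by simp)
  exact ENNReal.toReal_pos (hΩ_open.measure_pos volume hne).ne' hΩb.measure_lt_top.ne

theorem volume_piece_ne_zero {C₀ : ℝ} (hp : 2 ≤ p) (hV : 0 < volume.real Ω) (hC₀ : 0 < C₀)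
    (hbal : ∀ n, ∀ k < p ^ n, 1 / C₀ * (volume.real Ω / (p : ℝ) ^ n) ≤ volume.real (D n k)) :
    ∀ n, ∀ k < p ^ n, volume (D n k) ≠ 0 := by
  intro n k hk h
  have h1 := hbal n k hk
  have h0 : volume.real (D n k) = 0 := by rw [measureReal_def, h, ENNReal.toReal_zero]
  rw [h0] at h1
  have h2 : 0 < 1 / C₀ * (volume.real Ω / (p : ℝ) ^ n) := by positivity
  linarith

theorem exists_enorm_sub_pieceProj_sq_le (hd : 1 ≤ d) (hp : 2 ≤ p) (hΩ_open : IsOpen Ω)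
    (hΩb : Bornology.IsBounded Ω) (hD : IsMultiscaleDecomposition p Ω D)
    (hbal : IsWeaklyBalanced p Ω D) (hreg : IsRegularDecomposition p D) :
    ∃ C : ℝ≥0, ∀ (g : L2Space d) (f : L2On Ω), IsRestriction g f → ∀ n : ℕ,
      ‖f - pieceProj p Ω D n f‖ₑ ^ 2 ≤ C *
        ∫⁻ ξ, ENNReal.ofReal (min 1 (((1 + ‖ξ‖ ^ 2) ^ (1 / 2 : ℝ) /
          ((p : ℝ) ^ (1 / (d : ℝ))) ^ n) ^ 2)) * ‖(𝓕 g : L2Space d) ξ‖ₑ ^ 2 := by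
  obtain ⟨C₀, hC₀, hbal⟩ := hbal
  obtain ⟨c₁, hc₁, hdiam⟩ := hreg.1
  have hΩ : volume Ω ≠ ∞ := hΩb.measure_lt_top.ne
  have hV : 0 < volume.real Ω := volume_real_pos hΩ_open hΩb hD
  set q : ℝ := (p : ℝ) ^ (1 / (d : ℝ)) with hq
  have hp0 : (0 : ℝ) < p := by positivity
  have hq0 : 0 < q := by positivity
  have hqd : ∀ n : ℕ, (q ^ n) ^ d = (p : ℝ) ^ n := fun n => by
    rw [← pow_mul, mul_comm, pow_mul, hq, ← Real.rpow_natCast _ d, ← Real.rpow_mul hp0.le,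
      one_div_mul_cancel (by positivity), Real.rpow_one]
  -- Having `c ≥ 1` allows `c ^ 2` to be pulled out of the minimum in `enorm_translateL2_sub_sq_le`.
  set c : ℝ := max c₁ 1
  have hc : 1 ≤ c := le_max_right _ _
  set b : ℝ := volume.real (Metric.ball (0 : RSpace d) 1)
  -- The inverse piece volume contributes `C₀ / |Ω|` and a factor `p^n`, the ball of radius `c /
  -- q^n` contributes `c^d b` and `(q^n)^{-d} = p^{-n}`; the powers of `p` cancel. The last factor
  -- is the character bound.
  refine ⟨Real.toNNReal (C₀ / volume.real Ω * c ^ d * b * (4 * Real.pi ^ 2 * c ^ 2)),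
    fun g f hgf n => ?_⟩
  have hle : ∀ k < p ^ n, (C₀ * p ^ n / volume.real Ω)⁻¹ ≤ volume.real (D n k) := fun k hk => by
    refine le_trans (le_of_eq ?_) (hbal n k hk).1
    field_simp
  refine (enorm_sub_pieceProj_sq_le hD hΩ hΩb
    (K := ENNReal.ofReal (C₀ * p ^ n / volume.real Ω)) (δ := c / q ^ n) ?_
    (volume_piece_ne_zero hp hV (by linarith) fun n k hk => (hbal n k hk).1) ?_ hgf
    (fun h hh => enorm_translateL2_sub_sq_le g (by positivity) hc hh)).trans (le_of_eq ?_)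
  · intro k hk
    rw [ENNReal.inv_le_iff_inv_le, ← ENNReal.ofReal_inv_of_pos (by positivity)]
    exact ENNReal.ofReal_le_of_le_toReal (hle k hk)
  · intro k hk
    refine (hdiam n k hk).trans ?_
    have h1 : (p : ℝ) ^ (-((n : ℝ) / d)) = (q ^ n)⁻¹ := by
      rw [← Real.rpow_neg_one, hq, ← natCast_rpow_mul_div]
      congr 1; ring
    rw [h1, div_eq_mul_inv]
    gcongr
    exact le_max_left _ _
  · rw [Measure.addHaar_closedBall _ _ (by positivity), finrank_euclideanSpace_fin, div_pow, hqd,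
      ← ofReal_measureReal (measure_ball_lt_top.ne)]
    change _ = ENNReal.ofReal _ * _
    generalize ∫⁻ ξ, ENNReal.ofReal (min 1 (((1 + ‖ξ‖ ^ 2) ^ (1 / 2 : ℝ) / q ^ n) ^ 2)) *
      ‖(𝓕 g : L2Space d) ξ‖ₑ ^ 2 = I
    have hb : 0 ≤ b := measureReal_nonneg
    rw [← ENNReal.ofReal_mul (by positivity), mul_right_comm, ← ENNReal.ofReal_mul (by positivity),
      ← mul_assoc, ← ENNReal.ofReal_mul (by positivity)]
    congr 2
    field_simp
    rfl

theorem sobolevNormRn_mono {s t : ℝ} (hst : s ≤ t) (g : L2Space d) :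
    sobolevNormRn s g ≤ sobolevNormRn t g := by
  rw [← ENNReal.pow_le_pow_left_iff two_ne_zero, sobolevNormRn_sq, sobolevNormRn_sq]
  refine lintegral_mono fun ξ => ?_
  gcongr
  nlinarith [sq_nonneg ‖ξ‖]

theorem approxNorm_zero (f : L2On Ω) : approxNorm p Ω D 0 f = ‖f‖ₑ := if_pos rfl

theorem approxNorm_sq {r : ℝ} (hr : r ≠ 0) (f : L2On Ω) :
    approxNorm p Ω D r f ^ 2 = ‖pieceProj p Ω D 0 f‖ₑ ^ 2 +
      ∑' n : ℕ, ENNReal.ofReal ((((p : ℝ) ^ (1 / (d : ℝ))) ^ n) ^ (2 * r)) *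
        ‖f - pieceProj p Ω D n f‖ₑ ^ 2 := by
  rw [approxNorm, if_neg hr, ← ENNReal.rpow_natCast, ← ENNReal.rpow_mul]
  norm_num only
  rw [ENNReal.rpow_one]
  congr 1
  refine tsum_congr fun n => ?_
  rw [mul_pow, ← ENNReal.ofReal_pow (by positivity), natCast_rpow_mul_div, mul_comm 2 r,
    Real.rpow_mul (by positivity) r 2, Real.rpow_two]

theorem enorm_le_of_isRestriction {g : L2Space d} {f : L2On Ω} (hgf : IsRestriction g f) :
    ‖f‖ₑ ≤ ‖g‖ₑ := by
  rw [Lp.enorm_def, Lp.enorm_def, ← eLpNorm_congr_ae hgf]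
  exact eLpNorm_mono_measure _ Measure.restrict_le_self

theorem exists_approxNorm_le_sobolevNormRn (hd : 1 ≤ d) (hp : 2 ≤ p) (hΩ_open : IsOpen Ω)
    (hΩb : Bornology.IsBounded Ω) (hD : IsMultiscaleDecomposition p Ω D)
    (hbal : IsWeaklyBalanced p Ω D) (hreg : IsRegularDecomposition p D) {r s : ℝ} (hr : 0 ≤ r)
    (hrs : r ≤ s) (hs : s < 1) :
    ∃ C : ℝ≥0, 0 < C ∧ ∀ (g : L2Space d) (f : L2On Ω), IsRestriction g f →
      approxNorm p Ω D r f ≤ C * sobolevNormRn s g := by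
  -- The exponent `0` is separate because `approxNorm` is then the L² norm rather than the weighted
  -- sum.
  rcases hr.eq_or_lt with rfl | hr
  · refine ⟨1, one_pos, fun g f hgf => ?_⟩
    rw [approxNorm_zero, ENNReal.coe_one, one_mul]
    refine (enorm_le_of_isRestriction hgf).trans ?_
    rw [← sobolevNormRn_zero]
    exact sobolevNormRn_mono hrs g
  obtain ⟨A, hA⟩ := exists_enorm_sub_pieceProj_sq_le hd hp hΩ_open hΩb hD hbal hreg
  have hq1 : 1 < (p : ℝ) ^ (1 / (d : ℝ)) :=
    Real.one_lt_rpow (by exact_mod_cast hp) (by positivity)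
  obtain ⟨B, hB⟩ := exists_tsum_rpow_mul_min_le hq1 hr (hrs.trans_lt hs)
  set q : ℝ := (p : ℝ) ^ (1 / (d : ℝ))
  refine ⟨NNReal.sqrt (1 + A * B), by positivity, fun g f hgf => ?_⟩
  refine le_trans (ENNReal.le_sqrt_mul_of_sq_le ?_)
    (mul_le_mul_right (sobolevNormRn_mono hrs g) _)
  rw [approxNorm_sq hr.ne', ENNReal.coe_add, ENNReal.coe_one, add_mul, one_mul]
  refine add_le_add ?_ ?_
  · gcongr
    calc ‖pieceProj p Ω D 0 f‖ₑ ≤ ‖f‖ₑ := by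
          rw [← ofReal_norm, ← ofReal_norm]
          exact ENNReal.ofReal_le_ofReal (norm_pieceProj_le 0 f)
      _ ≤ ‖g‖ₑ := enorm_le_of_isRestriction hgf
      _ = sobolevNormRn 0 g := (sobolevNormRn_zero g).symm
      _ ≤ _ := sobolevNormRn_mono hr.le g
  · have hm : AEMeasurable (fun ξ => ‖(𝓕 g : L2Space d) ξ‖ₑ ^ 2) volume :=
      (Lp.stronglyMeasurable (𝓕 g : L2Space d)).measurable.enorm.pow_const 2 |>.aemeasurable
    calc _ ≤ ∑' n : ℕ, (A : ℝ≥0∞) * ∫⁻ ξ, ENNReal.ofReal ((q ^ n) ^ (2 * r) *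
            min 1 (((1 + ‖ξ‖ ^ 2) ^ (1 / 2 : ℝ) / q ^ n) ^ 2)) *
              ‖(𝓕 g : L2Space d) ξ‖ₑ ^ 2 := by
          refine ENNReal.tsum_le_tsum fun n => ?_
          refine (mul_le_mul_right (hA g f hgf n) _).trans (le_of_eq ?_)
          rw [mul_left_comm, ← lintegral_const_mul' _ _ ENNReal.ofReal_ne_top]
          congr 1
          refine lintegral_congr fun ξ => ?_
          rw [ENNReal.ofReal_mul (by positivity), mul_assoc]
      _ = A * ∫⁻ ξ, (∑' n : ℕ, ENNReal.ofReal ((q ^ n) ^ (2 * r) *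
            min 1 (((1 + ‖ξ‖ ^ 2) ^ (1 / 2 : ℝ) / q ^ n) ^ 2))) *
              ‖(𝓕 g : L2Space d) ξ‖ₑ ^ 2 := by
          rw [ENNReal.tsum_mul_left, ← lintegral_tsum]
          · simp_rw [ENNReal.tsum_mul_right]
          · exact fun n => AEMeasurable.mul (by fun_prop) hm
      _ ≤ A * ∫⁻ ξ, B * (ENNReal.ofReal ((1 + ‖ξ‖ ^ 2) ^ r) * ‖(𝓕 g : L2Space d) ξ‖ₑ ^ 2) := by
          refine mul_le_mul_right (lintegral_mono fun ξ => ?_) _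
          rw [← mul_assoc]
          gcongr
          refine (hB _ (Real.one_le_rpow (by nlinarith [sq_nonneg ‖ξ‖]) (by norm_num))).trans
            (le_of_eq ?_)
          rw [← Real.rpow_mul (by positivity)]
          ring_nf
      _ = _ := by
          rw [lintegral_const_mul' _ _ ENNReal.coe_ne_top, ← mul_assoc, sobolevNormRn_sq,
            ENNReal.coe_mul]

end

/-! ### Extension by zero and the inverse (Bernstein) estimate. -/

noncomputable section

variable {d : ℕ} {p : ℕ} {Ω : Set (RSpace d)} {D : ℕ → ℕ → Set (RSpace d)}

theorem memLp_indicator_of_L2On (hΩ : MeasurableSet Ω) (f : L2On Ω) :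
    MemLp (Ω.indicator f) 2 volume :=
  (memLp_indicator_iff_restrict hΩ).2 (Lp.memLp f)

/-- Extension by zero of square-integrable functions on `Ω`. -/
def extendZero (hΩ : MeasurableSet Ω) : L2On Ω →+ L2Space d :=
  AddMonoidHom.mk'
    (fun f => (memLp_indicator_of_L2On hΩ f).toLp)
    fun f g => by
      rw [← MemLp.toLp_add]
      refine MemLp.toLp_congr _ _ ?_
      filter_upwards [(ae_restrict_iff' hΩ).1 (Lp.coeFn_add f g)] with x hx
      by_cases h : x ∈ Ω
      · rw [Pi.add_apply, Set.indicator_of_mem h, Set.indicator_of_mem h, Set.indicator_of_mem h,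
          hx h, Pi.add_apply]
      · simp [h]

theorem coeFn_extendZero (hΩ : MeasurableSet Ω) (f : L2On Ω) :
    ⇑(extendZero hΩ f) =ᵐ[volume] Ω.indicator f := by
  have h : extendZero hΩ f = (memLp_indicator_of_L2On hΩ f).toLp := rfl
  rw [h]
  exact (memLp_indicator_of_L2On hΩ f).coeFn_toLp

theorem isRestriction_extendZero (hΩ : MeasurableSet Ω) (f : L2On Ω) :
    IsRestriction (extendZero hΩ f) f :=
  Filter.EventuallyEq.trans (ae_restrict_of_ae (coeFn_extendZero hΩ f))
    (indicator_ae_eq_restrict hΩ)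

theorem enorm_extendZero (hΩ : MeasurableSet Ω) (f : L2On Ω) : ‖extendZero hΩ f‖ₑ = ‖f‖ₑ := by
  rw [Lp.enorm_def, Lp.enorm_def, eLpNorm_congr_ae (coeFn_extendZero hΩ f),
    eLpNorm_indicator_eq_eLpNorm_restrict hΩ]

theorem norm_extendZero (hΩ : MeasurableSet Ω) (f : L2On Ω) : ‖extendZero hΩ f‖ = ‖f‖ := by
  rw [← toReal_enorm, ← toReal_enorm, enorm_extendZero]

theorem enorm_stepFun_sq_le {S T : ℕ → Set (RSpace d)} {N : ℕ} {a : ℕ → ℂ} {x : RSpace d}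
    (hS : ∀ k < N, ∀ l < N, k ≠ l → Disjoint (S k) (S l)) (h : ∀ k < N, x ∈ S k → x ∈ T k) :
    ‖stepFun S N a x‖ₑ ^ 2 ≤
      ∑ k ∈ Finset.range N, ‖a k‖ₑ ^ 2 * (T k).indicator (fun _ => (1 : ℝ≥0∞)) x := by
  by_cases hx : ∃ k < N, x ∈ S k
  · obtain ⟨k, hk, hxk⟩ := hx
    rw [stepFun_of_mem hS hk hxk]
    refine le_trans (le_of_eq ?_) (Finset.single_le_sum
      (f := fun k => ‖a k‖ₑ ^ 2 * (T k).indicator (fun _ => (1 : ℝ≥0∞)) x)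
      (fun _ _ => zero_le) (Finset.mem_range.2 hk))
    simp [h k hk hxk]
  · push Not at hx
    rw [stepFun_of_notMem hx]
    simp

theorem enorm_add_sq_le {E : Type*} [NormedAddCommGroup E] (z w : E) :
    ‖z + w‖ₑ ^ 2 ≤ 2 * (‖z‖ₑ ^ 2 + ‖w‖ₑ ^ 2) := by
  rw [← ofReal_norm, ← ofReal_norm, ← ofReal_norm, ← ENNReal.ofReal_ofNat 2,
    ← ENNReal.ofReal_pow (norm_nonneg _), ← ENNReal.ofReal_pow (norm_nonneg _),
    ← ENNReal.ofReal_pow (norm_nonneg _), ← ENNReal.ofReal_add (by positivity) (by positivity),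
    ← ENNReal.ofReal_mul (by norm_num)]
  exact ENNReal.ofReal_le_ofReal
    ((pow_le_pow_left₀ (norm_nonneg _) (norm_add_le z w) 2).trans add_sq_le)

theorem enorm_sub_sq_le {E : Type*} [NormedAddCommGroup E] (z w : E) :
    ‖z - w‖ₑ ^ 2 ≤ 2 * (‖z‖ₑ ^ 2 + ‖w‖ₑ ^ 2) := by
  simpa [sub_eq_add_neg] using enorm_add_sq_le z (-w)

theorem nullMeasurableSet_diff_image_add {S : Set (RSpace d)} (hS : NullMeasurableSet S volume)
    (h : RSpace d) : NullMeasurableSet (S \ ((fun x => x + h) '' S)) volume := by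
  refine hS.diff ?_
  rw [Set.image_add_right]
  exact hS.preimage (measurePreserving_add_right volume (-h)).quasiMeasurePreserving

/-- The difference vanishes when `x` and `x + h` share a set. Otherwise each of the two values is
seen only on a set of the form `S k \ (S k ± h)`, whose measure is at most `B`; hence `4 = 2 · 2`,
from squaring a difference and from the two values. -/
theorem lintegral_enorm_stepFun_sub_sq_le {S : ℕ → Set (RSpace d)} {N : ℕ} {a : ℕ → ℂ}
    (hS : ∀ k < N, ∀ l < N, k ≠ l → Disjoint (S k) (S l))
    (hm : ∀ k < N, NullMeasurableSet (S k) volume) {h : RSpace d} {B : ℝ≥0∞}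
    (hB : ∀ k < N, volume (S k \ ((fun x => x + h) '' S k)) ≤ B)
    (hB' : ∀ k < N, volume (S k \ ((fun x => x + -h) '' S k)) ≤ B) :
    ∫⁻ x, ‖stepFun S N a (x + h) - stepFun S N a x‖ₑ ^ 2 ≤
      4 * B * ∑ k ∈ Finset.range N, ‖a k‖ₑ ^ 2 := by
  set F : RSpace d → RSpace d → ℝ≥0∞ := fun u x => ∑ k ∈ Finset.range N,
    ‖a k‖ₑ ^ 2 * (S k \ ((fun x => x + u) '' S k)).indicator (fun _ => (1 : ℝ≥0∞)) x with hF
  have hterm : ∀ u, ∀ k ∈ Finset.range N, AEMeasurable (fun x => ‖a k‖ₑ ^ 2 *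
      (S k \ ((fun x => x + u) '' S k)).indicator (fun _ => (1 : ℝ≥0∞)) x) volume := fun u k hk =>
    (aemeasurable_const.indicator₀ (nullMeasurableSet_diff_image_add
      (hm k (Finset.mem_range.1 hk)) u)).const_mul _
  have hFm : ∀ u, AEMeasurable (F u) volume := fun u =>
    Finset.aemeasurable_fun_sum _ (hterm u)
  have hFint : ∀ u, (∀ k < N, volume (S k \ ((fun x => x + u) '' S k)) ≤ B) →
      ∫⁻ x, F u x ≤ B * ∑ k ∈ Finset.range N, ‖a k‖ₑ ^ 2 := by
    intro u hu
    rw [hF, lintegral_finsetSum' _ (hterm u), Finset.mul_sum]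
    refine Finset.sum_le_sum fun k hk => ?_
    rw [lintegral_const_mul' _ _ (by simp), mul_comm B]
    gcongr
    refine (lintegral_indicator_const_le _ _).trans ?_
    rw [one_mul]
    exact hu k (Finset.mem_range.1 hk)
  have hpt : ∀ x, ‖stepFun S N a (x + h) - stepFun S N a x‖ₑ ^ 2 ≤
      2 * (F h (x + h) + F (-h) x) := by
    intro x
    by_cases hx : ∃ k < N, x ∈ S k ∧ x + h ∈ S k
    · obtain ⟨k, hk, h1, h2⟩ := hx
      rw [stepFun_of_mem hS hk h1, stepFun_of_mem hS hk h2]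
      simp
    · push Not at hx
      refine (enorm_sub_sq_le _ _).trans ?_
      gcongr
      · refine enorm_stepFun_sq_le hS fun k hk hxk => ⟨hxk, ?_⟩
        rintro ⟨y, hy, hyx⟩
        rw [add_right_cancel hyx] at hy
        exact hx k hk hy hxk
      · refine enorm_stepFun_sq_le hS fun k hk hxk => ⟨hxk, ?_⟩
        rintro ⟨y, hy, hyx⟩
        refine hx k hk hxk ?_
        rw [← hyx]
        simpa using hy
  calc _ ≤ ∫⁻ x, 2 * (F h (x + h) + F (-h) x) := lintegral_mono hpt
    _ = 2 * ((∫⁻ x, F h x) + ∫⁻ x, F (-h) x) := by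
        rw [lintegral_const_mul' _ _ (by simp), lintegral_add_right' _ (hFm _),
          lintegral_add_right_eq_self (F h) h]
    _ ≤ 2 * (B * ∑ k ∈ Finset.range N, ‖a k‖ₑ ^ 2 + B * ∑ k ∈ Finset.range N, ‖a k‖ₑ ^ 2) := by
        gcongr
        · exact hFint h hB
        · exact hFint (-h) hB'
    _ = _ := by ring

theorem sum_enorm_sq_mul_volume_le (hD : IsMultiscaleDecomposition p Ω D) {n : ℕ} {v : L2On Ω}
    {a : ℕ → ℂ} (hv : ⇑v =ᵐ[volume.restrict Ω] stepFun (D n) (p ^ n) a) :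
    ∑ k ∈ Finset.range (p ^ n), ‖a k‖ₑ ^ 2 * volume (D n k) ≤ ‖v‖ₑ ^ 2 := by
  calc _ = ∑ k ∈ Finset.range (p ^ n), ∫⁻ x in D n k, ‖stepFun (D n) (p ^ n) a x‖ₑ ^ 2 := by
        refine Finset.sum_congr rfl fun k hk => ?_
        have hk' := Finset.mem_range.1 hk
        rw [← setLIntegral_const]
        refine lintegral_congr_ae ?_
        filter_upwards [ae_restrict_mem₀ (hD.nullMeasurableSet n k hk')] with x hx
        rw [stepFun_of_mem (hD.disjoint n) hk' hx]
    _ = ∫⁻ x in ⋃ k ∈ Finset.range (p ^ n), D n k, ‖stepFun (D n) (p ^ n) a x‖ₑ ^ 2 :=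
        (lintegral_biUnion_finset₀
          (fun k hk l hl hkl => (hD.disjoint n k (by simpa using hk) l (by simpa using hl)
            hkl).aedisjoint)
          (fun k hk => hD.nullMeasurableSet n k (Finset.mem_range.1 hk)) _).symm
    _ ≤ ∫⁻ x in Ω, ‖stepFun (D n) (p ^ n) a x‖ₑ ^ 2 :=
        lintegral_mono_set (Set.iUnion₂_subset fun k hk =>
          hD.subset n k (Finset.mem_range.1 hk))
    _ = _ := by
        rw [enorm_sq_eq_lintegral]
        refine lintegral_congr_ae ?_
        filter_upwards [hv] with x hx
        rw [hx]

/-- A Bernstein-type inequality for the piecewise constant functions on scale `n`. -/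
theorem exists_enorm_translateL2_sub_sq_le (hp : 2 ≤ p) (hΩ_open : IsOpen Ω)
    (hΩb : Bornology.IsBounded Ω) (hD : IsMultiscaleDecomposition p Ω D)
    (hbal : IsWeaklyBalanced p Ω D) (hreg : IsRegularDecomposition p D) (hd : 1 ≤ d) :
    ∃ C : ℝ, 0 ≤ C ∧ ∀ (n : ℕ), ∀ v ∈ pieceSpan p Ω D n, ∀ h : RSpace d,
      ‖translateL2 h (extendZero hΩ_open.measurableSet v) -
        extendZero hΩ_open.measurableSet v‖ₑ ^ 2 ≤
      ENNReal.ofReal (C * (‖h‖ * ((p : ℝ) ^ (1 / (d : ℝ))) ^ n)) * ‖v‖ₑ ^ 2 := by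
  obtain ⟨C₀, hC₀, hbal⟩ := hbal
  obtain ⟨c₂, hc₂, hreg⟩ := hreg.2
  have hΩ : volume Ω ≠ ∞ := hΩb.measure_lt_top.ne
  have hV : 0 < volume.real Ω := volume_real_pos hΩ_open hΩb hD
  have hp0 : (0 : ℝ) < p := by positivity
  -- The perimeter factor `p^{-n(d-1)/d}` equals `q^n / p^n`, and weak balance turns `p^{-n}` into
  -- at most `C₀ / |Ω|` times the volume of a piece.
  refine ⟨4 * c₂ * C₀ / volume.real Ω, by positivity, fun n v hv h => ?_⟩
  obtain ⟨a, ha⟩ := exists_eq_stepFun_of_mem_pieceSpan hv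
  set B : ℝ := c₂ * ‖h‖ * (p : ℝ) ^ (-((n : ℝ) * ((d : ℝ) - 1) / d)) with hBdef
  have hBle : ∀ u : RSpace d, ‖u‖ = ‖h‖ → ∀ k < p ^ n,
      volume (D n k \ ((fun x => x + u) '' D n k)) ≤ ENNReal.ofReal B := by
    intro u hu k hk
    refine (ENNReal.le_ofReal_iff_toReal_le
      (measure_ne_top_of_subset (Set.sdiff_subset.trans (hD.subset n k hk)) hΩ)
      (by positivity)).2 ?_
    rw [hBdef, ← hu]
    exact hreg u n k hk
  -- The extension is the same step function on all of `ℝ^d`, so jumps across the boundary of `Ω`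
  -- are covered by the regularity of the pieces.
  have hE : ⇑(extendZero hΩ_open.measurableSet v) =ᵐ[volume] stepFun (D n) (p ^ n) a := by
    filter_upwards [coeFn_extendZero hΩ_open.measurableSet v,
      (ae_restrict_iff' hΩ_open.measurableSet).1 ha] with x h1 h2
    rw [h1]
    by_cases hx : x ∈ Ω
    · rw [Set.indicator_of_mem hx, h2 hx]
    · rw [Set.indicator_of_notMem hx, stepFun_of_notMem fun k hk hxk => hx (hD.subset n k hk hxk)]
  have hE' := (measurePreserving_add_right volume h).quasiMeasurePreserving.ae_eq_comp hE
  calc _ = ∫⁻ x, ‖stepFun (D n) (p ^ n) a (x + h) - stepFun (D n) (p ^ n) a x‖ₑ ^ 2 := by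
        rw [enorm_sq_eq_lintegral]
        refine lintegral_congr_ae ?_
        filter_upwards [hE, hE', coeFn_translateL2 h (extendZero hΩ_open.measurableSet v),
          Lp.coeFn_sub (translateL2 h (extendZero hΩ_open.measurableSet v))
            (extendZero hΩ_open.measurableSet v)] with x h1 h2 h3 h4
        rw [h4, Pi.sub_apply, h3, h1]
        simp only [Function.comp_apply] at h2
        rw [h2]
    _ ≤ 4 * ENNReal.ofReal B * ∑ k ∈ Finset.range (p ^ n), ‖a k‖ₑ ^ 2 :=
        lintegral_enorm_stepFun_sub_sq_le (hD.disjoint n) (hD.nullMeasurableSet n)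
          (hBle h rfl) (hBle (-h) (norm_neg h))
    _ = ENNReal.ofReal (4 * c₂ * C₀ / volume.real Ω * (‖h‖ * ((p : ℝ) ^ (1 / (d : ℝ))) ^ n)) *
          ∑ k ∈ Finset.range (p ^ n),
            ‖a k‖ₑ ^ 2 * ENNReal.ofReal (1 / C₀ * (volume.real Ω / (p : ℝ) ^ n)) := by
        rw [← Finset.sum_mul, mul_comm (∑ k ∈ _, _), ← mul_assoc,
          ← ENNReal.ofReal_mul (by positivity)]
        congr 1
        rw [← ENNReal.ofReal_ofNat 4, ← ENNReal.ofReal_mul (by norm_num)]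
        congr 1
        have h1 : (p : ℝ) ^ (-((n : ℝ) * ((d : ℝ) - 1) / d)) =
            ((p : ℝ) ^ (1 / (d : ℝ))) ^ n / (p : ℝ) ^ n := by
          rw [← Real.rpow_natCast _ n, ← Real.rpow_mul hp0.le, ← Real.rpow_natCast _ n,
            ← Real.rpow_sub hp0]
          congr 1
          field_simp
          ring
        rw [hBdef, h1]
        field_simp
    _ ≤ _ := by
        gcongr
        refine le_trans (Finset.sum_le_sum fun k hk => ?_) (sum_enorm_sq_mul_volume_le hD ha)
        gcongr
        exact ENNReal.ofReal_le_of_le_toReal (hbal n k (Finset.mem_range.1 hk)).1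

end

/-! ### Increments, the Hardy inequality and the Sobolev norm of the zero extension. -/

noncomputable section

variable {d : ℕ} {p : ℕ} {Ω : Set (RSpace d)} {D : ℕ → ℕ → Set (RSpace d)}

variable (p Ω D) in
/-- The increments `P₀ f, P₁ f - P₀ f, P₂ f - P₁ f, …`. -/
def pieceIncr (f : L2On Ω) : ℕ → L2On Ω
  | 0 => pieceProj p Ω D 0 f
  | n + 1 => pieceProj p Ω D (n + 1) f - pieceProj p Ω D n f

theorem sum_pieceIncr (f : L2On Ω) (j : ℕ) :
    ∑ n ∈ Finset.range (j + 1), pieceIncr p Ω D f n = pieceProj p Ω D j f := by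
  induction j with
  | zero => simp [pieceIncr]
  | succ j ih => rw [Finset.sum_range_succ, ih, pieceIncr]; abel

theorem pieceIncr_mem (hD : IsMultiscaleDecomposition p Ω D) (hΩ : volume Ω ≠ ∞) (f : L2On Ω) :
    ∀ n, pieceIncr p Ω D f n ∈ pieceSpan p Ω D n
  | 0 => pieceProj_mem 0 f
  | n + 1 => Submodule.sub_mem _ (pieceProj_mem _ f)
      (pieceSpan_le_succ hD hΩ n (pieceProj_mem n f))

/-- The modulus of continuity at scale `j` is controlled by the approximation errors. -/
theorem exists_norm_translateL2_sub_le (hd : 1 ≤ d) (hp : 2 ≤ p) (hΩ_open : IsOpen Ω)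
    (hΩb : Bornology.IsBounded Ω) (hD : IsMultiscaleDecomposition p Ω D)
    (hbal : IsWeaklyBalanced p Ω D) (hreg : IsRegularDecomposition p D) :
    ∃ K : ℝ, 0 ≤ K ∧ ∀ (f : L2On Ω) (j : ℕ) (h : RSpace d),
      ‖h‖ ≤ (((p : ℝ) ^ (1 / (d : ℝ))) ^ j)⁻¹ →
      ‖translateL2 h (extendZero hΩ_open.measurableSet f) -
        extendZero hΩ_open.measurableSet f‖ ≤
      K * (∑ n ∈ Finset.range (j + 1), √((p : ℝ) ^ (1 / (d : ℝ))) ^ n * ‖pieceIncr p Ω D f n‖) /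
        √((p : ℝ) ^ (1 / (d : ℝ))) ^ j + 2 * ‖f - pieceProj p Ω D j f‖ := by
  obtain ⟨C, hC, hB⟩ := exists_enorm_translateL2_sub_sq_le hp hΩ_open hΩb hD hbal hreg hd
  set q : ℝ := (p : ℝ) ^ (1 / (d : ℝ)) with hq
  have hp0 : (0 : ℝ) < p := by positivity
  have hq0 : 0 < q := by positivity
  have hσ : 0 < √q := Real.sqrt_pos.2 hq0
  refine ⟨√C, Real.sqrt_nonneg _, fun f j h hh => ?_⟩
  have hΩm := hΩ_open.measurableSet
  set E := extendZero hΩm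
  let T : L2On Ω →+ L2Space d :=
    ((translateL2 h).toLinearMap.toAddMonoidHom.comp E) - E
  have hT : ∀ u, T u = translateL2 h (E u) - E u := fun u => rfl
  have hTle : ∀ u, ‖T u‖ ≤ 2 * ‖u‖ := fun u => by
    rw [hT]
    refine (norm_sub_le _ _).trans (le_of_eq ?_)
    rw [LinearIsometry.norm_map, norm_extendZero]
    ring
  -- The Bernstein estimate is linear in `|h|` for the squared norm, so only `(q^n / q^j)^{1/2}`
  -- remains; this is the origin of the threshold `s < 1/2`.
  have hbern : ∀ n, ‖T (pieceIncr p Ω D f n)‖ ≤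
      √C * (√q ^ n * ‖pieceIncr p Ω D f n‖) / √q ^ j := fun n => by
    have h1 := hB n _ (pieceIncr_mem hD hΩb.measure_lt_top.ne f n) h
    rw [← ofReal_norm, ← ofReal_norm, ← ENNReal.ofReal_pow (norm_nonneg _),
      ← ENNReal.ofReal_pow (norm_nonneg _), ← ENNReal.ofReal_mul (by positivity),
      ENNReal.ofReal_le_ofReal_iff (by positivity)] at h1
    refine abs_le_of_sq_le_sq' ?_ (by positivity) |>.2
    refine h1.trans ?_
    rw [div_pow, mul_pow, mul_pow, Real.sq_sqrt hC, ← pow_mul, mul_comm n 2, pow_mul,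
      Real.sq_sqrt hq0.le, ← pow_mul, mul_comm j 2, pow_mul, Real.sq_sqrt hq0.le]
    calc _ ≤ C * ((q ^ j)⁻¹ * q ^ n) * ‖pieceIncr p Ω D f n‖ ^ 2 := by gcongr
      _ = _ := by ring
  -- Coarse increments gain from the small shift; the part finer than scale `j` is bounded trivially
  -- by twice its norm.
  have hsplit : T f = ∑ n ∈ Finset.range (j + 1), T (pieceIncr p Ω D f n) +
      T (f - pieceProj p Ω D j f) := by
    rw [← map_sum, sum_pieceIncr, ← map_add]
    congr 1
    abel
  calc ‖T f‖ ≤ ∑ n ∈ Finset.range (j + 1), ‖T (pieceIncr p Ω D f n)‖ +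
        ‖T (f - pieceProj p Ω D j f)‖ := by
        rw [hsplit]
        exact (norm_add_le _ _).trans (by gcongr; exact norm_sum_le _ _)
    _ ≤ ∑ n ∈ Finset.range (j + 1), √C * (√q ^ n * ‖pieceIncr p Ω D f n‖) / √q ^ j +
        2 * ‖f - pieceProj p Ω D j f‖ := by
        gcongr with n _
        · exact hbern n
        · exact hTle _
    _ = _ := by rw [← Finset.sum_div, ← Finset.mul_sum]

theorem approxNorm_mono {r s : ℝ} (hs : 0 < s) (hsr : s ≤ r) (hp : 2 ≤ p) (f : L2On Ω) :
    approxNorm p Ω D s f ≤ approxNorm p Ω D r f := by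
  rw [← ENNReal.pow_le_pow_left_iff two_ne_zero, approxNorm_sq hs.ne',
    approxNorm_sq (hs.trans_le hsr).ne']
  gcongr with n
  refine one_le_pow₀ (Real.one_le_rpow ?_ (by positivity))
  exact_mod_cast (by omega : 1 ≤ p)

/-- Split off `P_0 f`; the remainder is the summand `n = 0`, whose weight is `1`. -/
theorem enorm_sq_le_approxNorm_sq {s : ℝ} (hs : s ≠ 0) (f : L2On Ω) :
    ‖f‖ₑ ^ 2 ≤ 2 * approxNorm p Ω D s f ^ 2 := by
  have h1 := enorm_add_sq_le (pieceProj p Ω D 0 f) (f - pieceProj p Ω D 0 f)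
  rw [add_sub_cancel] at h1
  refine h1.trans ?_
  rw [approxNorm_sq hs]
  gcongr
  refine le_trans (le_of_eq ?_) (ENNReal.le_tsum 0)
  simp

/-- A discrete Hardy inequality for the increments. -/
theorem tsum_hardy_pieceIncr_le (hD : IsMultiscaleDecomposition p Ω D)
    (hΩ : volume Ω ≠ ∞) (hd : 1 ≤ d) (hp : 2 ≤ p) {s : ℝ} (hs : 0 < s) (hs2 : s < 1 / 2) :
    ∃ C : ℝ≥0, ∀ f : L2On Ω,
      ∑' j : ℕ, ENNReal.ofReal ((((p : ℝ) ^ (1 / (d : ℝ))) ^ j) ^ (2 * s) *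
        ((∑ n ∈ Finset.range (j + 1), √((p : ℝ) ^ (1 / (d : ℝ))) ^ n * ‖pieceIncr p Ω D f n‖) /
          √((p : ℝ) ^ (1 / (d : ℝ))) ^ j) ^ 2) ≤ C * approxNorm p Ω D s f ^ 2 := by
  have hq1 : 1 < (p : ℝ) ^ (1 / (d : ℝ)) :=
    Real.one_lt_rpow (by exact_mod_cast hp) (by positivity)
  have happ := fun f => approxNorm_sq (p := p) (D := D) (Ω := Ω) hs.ne' f
  set q : ℝ := (p : ℝ) ^ (1 / (d : ℝ)) with hq
  have hq0 : 0 < q := by linarith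
  have hσ : 0 < √q := Real.sqrt_pos.2 hq0
  set ω : ℝ := q ^ s with hω
  have hω1 : 1 ≤ ω := Real.one_le_rpow hq1.le hs.le
  have hω0 : 0 < ω := by positivity
  have hωσ : ω < √q := by
    rw [Real.sqrt_eq_rpow]
    exact Real.rpow_lt_rpow_of_exponent_lt hq1 hs2
  have hpow : ∀ j : ℕ, (q ^ j) ^ (2 * s) = (ω ^ j) ^ 2 := fun j => by
    rw [hω, ← Real.rpow_natCast q, ← Real.rpow_mul hq0.le, ← Real.rpow_natCast (q ^ s),
      ← Real.rpow_mul hq0.le, ← Real.rpow_natCast _ 2, ← Real.rpow_mul hq0.le]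
    congr 1
    push_cast
    ring
  set θ : ℝ := ω / √q with hθ
  have hθ0 : 0 ≤ θ := by positivity
  have hθ1 : θ < 1 := (div_lt_one hσ).2 hωσ
  have hc : 0 < (1 - θ) ^ 2 := by
    have : 0 < 1 - θ := by linarith
    positivity
  -- The first factor comes from `sum_sq_le_of_contraction`. The factor `ω ^ 2` pays for an index
  -- shift: increment `n + 1`, with weight `ω ^ (n + 1)`, is bounded by the error at scale `n`.
  refine ⟨Real.toNNReal (((1 - θ) ^ 2)⁻¹ * ω ^ 2), fun f => ?_⟩
  set b : ℕ → ℝ := fun n => ω ^ n * ‖pieceIncr p Ω D f n‖ with hb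
  set S : ℕ → ℝ := fun j => ω ^ j *
    ((∑ n ∈ Finset.range (j + 1), √q ^ n * ‖pieceIncr p Ω D f n‖) / √q ^ j) with hS
  -- The recursion `S (j + 1) = θ * S j + b (j + 1)` holds with equality, and `θ = q^{s-1/2}`.
  have hSb := sum_sq_le_of_contraction (S := S) (b := b) hθ0 hθ1
    (fun j => by positivity) (by simp [hS, hb]) (fun j => by
      simp only [hS, hb]
      rw [Finset.sum_range_succ _ (j + 1), hθ, pow_succ ω, pow_succ √q j]
      refine le_of_eq ?_
      field_simp)
  have hbsum : ∑' n, ENNReal.ofReal (b n ^ 2) ≤ ENNReal.ofReal (ω ^ 2) *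
      approxNorm p Ω D s f ^ 2 := by
    rw [happ, tsum_eq_zero_add' ENNReal.summable, mul_add, ← ENNReal.tsum_mul_left]
    refine add_le_add ?_ (ENNReal.tsum_le_tsum fun n => ?_)
    · rw [← ofReal_norm, ← ENNReal.ofReal_pow (norm_nonneg _), ← ENNReal.ofReal_mul (by positivity)]
      refine ENNReal.ofReal_le_ofReal ?_
      simp only [hb, pow_zero, one_mul, pieceIncr]
      exact le_mul_of_one_le_left (by positivity) (one_le_pow₀ hω1)
    · rw [← ofReal_norm, ← ENNReal.ofReal_pow (norm_nonneg _), ← ENNReal.ofReal_mul (by positivity),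
        ← ENNReal.ofReal_mul (by positivity)]
      refine ENNReal.ofReal_le_ofReal ?_
      have h1 : ‖pieceIncr p Ω D f (n + 1)‖ ≤ ‖f - pieceProj p Ω D n f‖ :=
        norm_pieceProj_succ_sub_le hD hΩ n f
      simp only [hb]
      rw [hpow, ← mul_assoc, ← mul_pow, ← mul_pow, pow_succ' ω n]
      gcongr
  calc _ = ∑' j, ENNReal.ofReal (S j ^ 2) := by
        refine tsum_congr fun j => ?_
        simp only [hS]
        rw [hpow, ← mul_pow]
    _ ≤ ENNReal.ofReal ((1 - θ) ^ 2)⁻¹ * ∑' n, ENNReal.ofReal (b n ^ 2) := by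
        refine ENNReal.tsum_le_of_sum_range_le fun J => ?_
        refine le_trans ?_ (mul_le_mul_right (ENNReal.sum_le_tsum (Finset.range J)) _)
        rw [← ENNReal.ofReal_sum_of_nonneg fun _ _ => by positivity,
          ← ENNReal.ofReal_sum_of_nonneg fun _ _ => by positivity,
          ← ENNReal.ofReal_mul (by positivity)]
        refine ENNReal.ofReal_le_ofReal ?_
        rw [inv_mul_eq_div, le_div_iff₀ hc, mul_comm]
        exact hSb J
    _ ≤ ENNReal.ofReal ((1 - θ) ^ 2)⁻¹ * (ENNReal.ofReal (ω ^ 2) * approxNorm p Ω D s f ^ 2) := by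
        gcongr
    _ = _ := by
        rw [← mul_assoc, ← ENNReal.ofReal_mul (by positivity)]
        rfl

/-- The pointwise weight bound, integrated against `|ĝ|²` and translated back by Plancherel:
countably many shifts control the Sobolev norm. -/
theorem exists_sobolevNormRn_sq_le {q s : ℝ} (hq : 1 < q) (hs : 0 ≤ s) :
    ∃ C : ℝ≥0, ∀ g : L2Space d, sobolevNormRn s g ^ 2 ≤ C * (‖g‖ₑ ^ 2 +
      ∑' j : ℕ, ENNReal.ofReal ((q ^ j) ^ (2 * s)) * ∑ i : Fin d,
        ‖translateL2 (EuclideanSpace.single i ((q ^ j)⁻¹ / 2)) g - g‖ₑ ^ 2) := by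
  obtain ⟨C, hC⟩ := exists_one_add_norm_sq_rpow_le (d := d) hq hs
  refine ⟨C, fun g => ?_⟩
  have hm : Measurable (fun ξ => ‖(𝓕 g : L2Space d) ξ‖ₑ ^ 2) :=
    (Lp.stronglyMeasurable (𝓕 g : L2Space d)).measurable.enorm.pow_const 2
  have hchar : ∀ h : RSpace d, Measurable (fun ξ : RSpace d =>
      ‖((Real.fourierChar (inner ℝ h ξ) : Circle) : ℂ) - 1‖ₑ ^ 2 *
        ‖(𝓕 g : L2Space d) ξ‖ₑ ^ 2) := fun h => by
    refine Measurable.mul ?_ hm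
    refine Measurable.pow_const (Measurable.enorm (Continuous.measurable ?_)) 2
    fun_prop
  have hg : ‖g‖ₑ ^ 2 = ∫⁻ ξ, ‖(𝓕 g : L2Space d) ξ‖ₑ ^ 2 := by
    rw [← enorm_sq_eq_lintegral]
    congr 1
    exact ((Lp.fourierTransformₗᵢ (RSpace d) ℂ).enorm_map g).symm
  simp_rw [enorm_translateL2_sub_sq]
  rw [sobolevNormRn_sq, hg]
  calc _ ≤ ∫⁻ ξ, C * (‖(𝓕 g : L2Space d) ξ‖ₑ ^ 2 + ∑' j : ℕ, ENNReal.ofReal ((q ^ j) ^ (2 * s)) *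
        ∑ i : Fin d, ‖((Real.fourierChar (inner ℝ
          (EuclideanSpace.single i ((q ^ j)⁻¹ / 2) : RSpace d) ξ) : Circle) : ℂ) - 1‖ₑ ^ 2 *
            ‖(𝓕 g : L2Space d) ξ‖ₑ ^ 2) := by
        refine lintegral_mono fun ξ => ?_
        refine (mul_le_mul_left (hC ξ) _).trans (le_of_eq ?_)
        rw [mul_assoc, add_mul, one_mul, ← ENNReal.tsum_mul_right]
        simp_rw [mul_assoc, Finset.sum_mul]
    _ = _ := by
        rw [lintegral_const_mul' _ _ ENNReal.coe_ne_top, lintegral_add_left hm, lintegral_tsum]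
        · congr 3
          funext j
          rw [lintegral_const_mul' _ _ ENNReal.ofReal_ne_top, lintegral_finsetSum]
          exact fun i _ => hchar _
        · exact fun j => (Measurable.const_mul
            (Finset.measurable_fun_sum _ fun i _ => hchar _) _).aemeasurable

theorem exists_sobolevNormRn_extendZero_le (hd : 1 ≤ d) (hp : 2 ≤ p) (hΩ_open : IsOpen Ω)
    (hΩb : Bornology.IsBounded Ω) (hD : IsMultiscaleDecomposition p Ω D)
    (hbal : IsWeaklyBalanced p Ω D) (hreg : IsRegularDecomposition p D) {r s : ℝ} (hs : 0 ≤ s)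
    (hs2 : s < 1 / 2) (hsr : s ≤ r) :
    ∃ C : ℝ≥0, ∀ f : L2On Ω, sobolevNormRn s (extendZero hΩ_open.measurableSet f) ≤
      C * approxNorm p Ω D r f := by
  rcases hs.eq_or_lt with rfl | hs
  · rcases hsr.eq_or_lt with rfl | hr
    · refine ⟨1, fun f => ?_⟩
      rw [sobolevNormRn_zero, enorm_extendZero, approxNorm_zero, ENNReal.coe_one, one_mul]
    · refine ⟨NNReal.sqrt 2, fun f => ENNReal.le_sqrt_mul_of_sq_le ?_⟩
      rw [sobolevNormRn_zero, enorm_extendZero]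
      exact enorm_sq_le_approxNorm_sq hr.ne' f
  obtain ⟨K, hK0, hK⟩ := exists_norm_translateL2_sub_le hd hp hΩ_open hΩb hD hbal hreg
  obtain ⟨H, hH⟩ := tsum_hardy_pieceIncr_le hD hΩb.measure_lt_top.ne hd hp hs hs2
  have hq1 : 1 < (p : ℝ) ^ (1 / (d : ℝ)) :=
    Real.one_lt_rpow (by exact_mod_cast hp) (by positivity)
  obtain ⟨A, hA⟩ := exists_sobolevNormRn_sq_le (d := d) hq1 hs.le
  have happ := fun f => approxNorm_sq (p := p) (D := D) (Ω := Ω) hs.ne' f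
  set q : ℝ := (p : ℝ) ^ (1 / (d : ℝ)) with hq
  have hq0 : 0 < q := by linarith
  have hΩm := hΩ_open.measurableSet
  -- The `2` bounds the L² part, `d` counts coordinate directions, `2 K² H` comes from the Hardy
  -- term, and `8 = 2 · 2²` from the remainder.
  refine ⟨NNReal.sqrt (A * (2 + d * (2 * K.toNNReal ^ 2 * H + 8))), fun f => le_trans
    (ENNReal.le_sqrt_mul_of_sq_le ?_) (mul_le_mul_right (approxNorm_mono hs hsr hp f) _)⟩
  set N := approxNorm p Ω D s f with hN
  have hmod : ∀ (j : ℕ) (i : Fin d), ENNReal.ofReal ((q ^ j) ^ (2 * s)) *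
      ‖translateL2 (EuclideanSpace.single i ((q ^ j)⁻¹ / 2)) (extendZero hΩm f) -
        extendZero hΩm f‖ₑ ^ 2 ≤
      2 * (K.toNNReal : ℝ≥0∞) ^ 2 * ENNReal.ofReal ((q ^ j) ^ (2 * s) *
        ((∑ n ∈ Finset.range (j + 1), √q ^ n * ‖pieceIncr p Ω D f n‖) / √q ^ j) ^ 2) +
      8 * (ENNReal.ofReal ((q ^ j) ^ (2 * s)) * ‖f - pieceProj p Ω D j f‖ₑ ^ 2) := by
    intro j i
    have h1 := hK f j (EuclideanSpace.single i ((q ^ j)⁻¹ / 2)) (by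
      rw [PiLp.norm_single, Real.norm_of_nonneg (by positivity)]
      exact half_le_self (by positivity))
    have hKe : (K.toNNReal : ℝ≥0∞) = ENNReal.ofReal K := rfl
    rw [mul_div_assoc] at h1
    rw [hKe, ← ofReal_norm, ← ofReal_norm]
    have hZ : 0 ≤ (∑ n ∈ Finset.range (j + 1), √q ^ n * ‖pieceIncr p Ω D f n‖) / √q ^ j := by
      positivity
    have hτ := norm_nonneg (translateL2 (EuclideanSpace.single i ((q ^ j)⁻¹ / 2))
      (extendZero hΩm f) - extendZero hΩm f)
    have hε := norm_nonneg (f - pieceProj p Ω D j f)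
    generalize (∑ n ∈ Finset.range (j + 1), √q ^ n * ‖pieceIncr p Ω D f n‖) / √q ^ j = Z
      at h1 hZ ⊢
    generalize ‖translateL2 (EuclideanSpace.single i ((q ^ j)⁻¹ / 2))
      (extendZero hΩm f) - extendZero hΩm f‖ = τ at h1 hτ ⊢
    generalize ‖f - pieceProj p Ω D j f‖ = ε at h1 hε ⊢
    rw [← ENNReal.ofReal_pow hτ, ← ENNReal.ofReal_pow hε, ← ENNReal.ofReal_pow hK0,
      ← ENNReal.ofReal_ofNat 2, ← ENNReal.ofReal_ofNat 8, ← ENNReal.ofReal_mul (by positivity),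
      ← ENNReal.ofReal_mul (by positivity), ← ENNReal.ofReal_mul (by positivity),
      ← ENNReal.ofReal_mul (by positivity), ← ENNReal.ofReal_mul (by positivity),
      ← ENNReal.ofReal_add (by positivity) (by positivity)]
    refine ENNReal.ofReal_le_ofReal ?_
    have h2 := (pow_le_pow_left₀ hτ h1 2).trans add_sq_le
    have h3 : 0 ≤ (q ^ j) ^ (2 * s) := by positivity
    calc _ ≤ (q ^ j) ^ (2 * s) * (2 * ((K * Z) ^ 2 + (2 * ε) ^ 2)) := by
          gcongr
      _ = _ := by ring
  have hsum : ∑' j : ℕ, ENNReal.ofReal ((q ^ j) ^ (2 * s)) * ∑ i : Fin d,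
      ‖translateL2 (EuclideanSpace.single i ((q ^ j)⁻¹ / 2)) (extendZero hΩm f) -
        extendZero hΩm f‖ₑ ^ 2 ≤ d * (2 * (K.toNNReal : ℝ≥0∞) ^ 2 * H + 8) * N ^ 2 := by
    simp_rw [Finset.mul_sum]
    refine (ENNReal.tsum_le_tsum fun j => Finset.sum_le_sum fun i _ => hmod j i).trans ?_
    simp only [Finset.sum_const, Finset.card_univ, Fintype.card_fin, nsmul_eq_mul]
    rw [ENNReal.tsum_mul_left, mul_assoc]
    gcongr
    rw [ENNReal.tsum_add, ENNReal.tsum_mul_left, ENNReal.tsum_mul_left, add_mul,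
      mul_assoc _ (H : ℝ≥0∞)]
    gcongr
    · exact hH f
    · rw [hN, happ]
      exact le_add_self
  refine (hA _).trans ?_
  rw [enorm_extendZero]
  refine (mul_le_mul_right (add_le_add (enorm_sq_le_approxNorm_sq (p := p) (D := D) hs.ne' f) hsum) _).trans
    (le_of_eq ?_)
  push_cast
  ring

end

/-! ### The two embeddings and the equivalence of norms. -/

noncomputable section

variable {d : ℕ} {p : ℕ} {Ω : Set (RSpace d)} {D : ℕ → ℕ → Set (RSpace d)}

theorem sobolevSpace_embeds_approxSpace (hd : 1 ≤ d) (hp : 2 ≤ p) (hΩ_open : IsOpen Ω)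
    (hΩb : Bornology.IsBounded Ω) (hD : IsMultiscaleDecomposition p Ω D)
    (hbal : IsWeaklyBalanced p Ω D) (hreg : IsRegularDecomposition p D) {r s : ℝ} (hr : 0 ≤ r)
    (hrs : r ≤ s) (hs : s < 1) :
    ContinuouslyEmbeds (sobolevSpace Ω s) (sobolevNorm Ω s)
      (approxSpace p Ω D r) (approxNorm p Ω D r) := by
  obtain ⟨C, hC0, hC⟩ :=
    exists_approxNorm_le_sobolevNormRn hd hp hΩ_open hΩb hD hbal hreg hr hrs hs
  refine ⟨?_, C, fun f _ => ?_⟩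
  · rintro f ⟨g, hg, hgf⟩
    exact (hC g f hgf).trans_lt (ENNReal.mul_lt_top ENNReal.coe_lt_top hg)
  -- Dividing by the positive constant reduces the quotient norm to a bound for each competing
  -- extension.
  · rw [mul_comm, ← ENNReal.div_le_iff (by exact_mod_cast hC0.ne') ENNReal.coe_ne_top]
    refine le_iInf₂ fun g hg => ?_
    rw [ENNReal.div_le_iff (by exact_mod_cast hC0.ne') ENNReal.coe_ne_top, mul_comm]
    exact hC g f hg.2

theorem approxSpace_embeds_sobolevSpace (hd : 1 ≤ d) (hp : 2 ≤ p) (hΩ_open : IsOpen Ω)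
    (hΩb : Bornology.IsBounded Ω) (hD : IsMultiscaleDecomposition p Ω D)
    (hbal : IsWeaklyBalanced p Ω D) (hreg : IsRegularDecomposition p D) {r s : ℝ} (hs : 0 ≤ s)
    (hs2 : s < 1 / 2) (hsr : s ≤ r) :
    ContinuouslyEmbeds (approxSpace p Ω D r) (approxNorm p Ω D r)
      (sobolevSpace Ω s) (sobolevNorm Ω s) := by
  obtain ⟨C, hC⟩ :=
    exists_sobolevNormRn_extendZero_le hd hp hΩ_open hΩb hD hbal hreg hs hs2 hsr
  have hmem : ∀ f ∈ approxSpace p Ω D r,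
      extendZero hΩ_open.measurableSet f ∈ sobolevSpaceRn d s := fun f hf =>
    (hC f).trans_lt (ENNReal.mul_lt_top ENNReal.coe_lt_top hf)
  -- The zero extension is the competitor in the infimum.
  exact ⟨fun f hf => ⟨_, hmem f hf, isRestriction_extendZero _ f⟩, C, fun f hf =>
    (iInf₂_le _ ⟨hmem f hf, isRestriction_extendZero _ f⟩).trans (hC f)⟩

end

theorem mainTheorem5 (d p : ℕ) (hd : 1 ≤ d) (hp : 2 ≤ p)
    (Ω : Set (RSpace d)) (hΩ_open : IsOpen Ω) (hΩ_bdd : Bornology.IsBounded Ω)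
    (hΩ_lip : HasLipschitzBoundary Ω)
    (D : ℕ → ℕ → Set (RSpace d)) (hD : IsMultiscaleDecomposition p Ω D)
    (hD_bal : IsWeaklyBalanced p Ω D) (hD_reg : IsRegularDecomposition p D) :
    (∀ r s : ℝ, 0 ≤ r → r ≤ s → s < 1 →
      ContinuouslyEmbeds (sobolevSpace Ω s) (sobolevNorm Ω s)
        (approxSpace p Ω D r) (approxNorm p Ω D r)) ∧
    (∀ r s : ℝ, 0 ≤ s → s < 1 / 2 → s ≤ r →
      ContinuouslyEmbeds (approxSpace p Ω D r) (approxNorm p Ω D r)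
        (sobolevSpace Ω s) (sobolevNorm Ω s)) ∧
    (∀ r : ℝ, 0 ≤ r → r < 1 / 2 →
      approxSpace p Ω D r = sobolevSpace Ω r ∧
      ∃ c C : ℝ≥0, 0 < c ∧ 0 < C ∧ ∀ f ∈ sobolevSpace Ω r,
        c * sobolevNorm Ω r f ≤ approxNorm p Ω D r f ∧
        approxNorm p Ω D r f ≤ C * sobolevNorm Ω r f) := by
  have h1 := fun (r s : ℝ) (hr : 0 ≤ r) (hrs : r ≤ s) (hs : s < 1) =>
    sobolevSpace_embeds_approxSpace hd hp hΩ_open hΩ_bdd hD hD_bal hD_reg hr hrs hs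
  have h2 := fun (r s : ℝ) (hs : 0 ≤ s) (hs2 : s < 1 / 2) (hsr : s ≤ r) =>
    approxSpace_embeds_sobolevSpace hd hp hΩ_open hΩ_bdd hD hD_bal hD_reg hs hs2 hsr
  refine ⟨h1, h2, fun r hr hr2 => ?_⟩
  obtain ⟨hsub, C, hC⟩ := h1 r r hr le_rfl (by linarith)
  obtain ⟨hsub', C', hC'⟩ := h2 r r hr hr2 le_rfl
  -- Adding `1` makes the constants positive, since an embedding constant may be `0`.
  refine ⟨hsub'.antisymm hsub, (C' + 1)⁻¹, C + 1, by positivity, by positivity, fun f hf => ⟨?_, ?_⟩⟩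
  · rw [ENNReal.coe_inv (by positivity), ← ENNReal.div_eq_inv_mul]
    refine ENNReal.div_le_of_le_mul ?_
    rw [mul_comm]
    refine (hC' f (hsub hf)).trans ?_
    gcongr
    simp
  · refine (hC f hf).trans ?_
    gcongr
    simp
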